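/- **Setting.** Let $n,m\ge 1$, $A\in\mathbb R^{m\times n}$, let $f_0:\mathbb R^n\to\mathbb R$ be convex and differentiable with $L_0$-Lipschitz gradient, and let $g:\mathbb R^n\to\mathbb R\cup\{+\infty\}$, $h:\mathbb R^m\to\mathbb R\cup\{+\infty\}$ be proper, closed and convex. Let $\mathcal M^x\in\mathbb R^{n\times n}$, $\mathcal M^\lambda\in\mathbb R^{m\times m}$ be symmetric positive definite, $\mathcal M=\operatorname{diag}(\mathcal M^x,\mathcal M^\lambda)$, $\|z\|_{\mathcal M}=\sqrt{\langle z,\mathcal Mz\rangle}$ (similarly for $\mathcal M^x,\mathcal M^\lambda$), and let $\sigma,\eta,\delta>0$, $\bar x\in\mathbb R^n$, $\bar\lambda\in\mathbb R^m$. Let $\ell(x,\lambda)=f_0(x)+g(x)+\langle Ax,\lambda\rangle-h^*(\lambda)$, where $h^*$ is the Fenchel conjugate, let $T_\ell(x,\lambda)=\{(v,u):(v,-u)\in\partial\ell(x,\lambda)\}$ (convex-concave subdifferential), and $\mathcal J_{\sigma\mathcal M^{-1}T_\ell}=(I+\sigma\mathcal M^{-1}T_\ell)^{-1}$. Put $$\Lambda(x)=\arg\max_{\lambda}\Big\{\ell(x,\lambda)-\tfrac1{2\sigma}\|\lambda-\bar\lambda\|^2_{\mathcal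 M^\lambda}\Big\},\qquad \psi(u)=\max_\lambda\Big\{\langle u,\lambda\rangle-h^*(\lambda)-\tfrac1{2\sigma}\|\lambda-\bar\lambda\|^2_{\mathcal M^\lambda}\Big\},$$ $$F(x)=\max_{\lambda}\Big\{\ell(x,\lambda)-\tfrac1{2\sigma}\|\lambda-\bar\lambda\|^2_{\mathcal M^\lambda}\Big\}+\tfrac1{2\sigma}\|x-\bar x\|^2_{\mathcal M^x},\qquad F^\star=\min_x F(x),$$ $$f(x)=f_0(x)+\psi(Ax),\qquad \phi(x)=g(x)+\tfrac1{2\sigma}\|x-\bar x\|_{\mathcal M^x}^2,\qquad L=L_0+\frac{\sigma}{\lambda_{\min}(\mathcal M^\lambda)}\|A\|^2,$$ where $\|A\|$ is the spectral norm and $\lambda_{\min}$ the smallest eigenvalue; assume $L>0$. Let $$\mathcal G_F(x)=\arg\min_{y}\Big\{\tfrac L2\big\|y-\big(x-\tfrac1L\nabla f(x)\big)\big\|^2+\phi(y)\Big\}.$$ **Proposition.** All these objects are well defined: $\psi$ is finite, $f$ is differentiable, $F=f+\phi$, $F^\star$ is finite, $F$ has a unique minimizer, $\Lambda(x)$ (for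 $x\in\operatorname{dom} g$) and $\mathcal G_F(x)$ (for every $x$) are single points, and $\mathcal J_{\sigma\mathcal M^{-1}T_\ell}$ is single-valued and everywhere defined. Moreover: 1. If $y\in\mathbb R^n$ satisfies $$F(y)-F^\star\le\frac{\lambda_{\min}(\mathcal M^x)}{\sigma^2}\min\left\{\frac{\eta^2}{4L},\ \frac{\delta^2\lambda_{\min}(\mathcal M)}{2(1+\delta)^2L^2}\big(F(\mathcal G_F(\bar x))-F^\star\big)\right\},$$ then $\tilde x=\mathcal G_F(y)$ satisfies the computable stopping criterion $$\operatorname{dist}(\mathbf 0,\partial F(\tilde x))\le\frac{\sqrt{\lambda_{\min}(\mathcal M^x)}}{\sigma}\min\Big\{\eta,\ \delta\,\big\|(\tilde x,\Lambda(\tilde x))-(\bar x,\bar\lambda)\big\|_{\mathcal M}\Big\},\tag{S}$$ where the distance to the empty set is $+\infty$. 2. Every $\tilde x\in\mathbb R^n$ that satisfies (S) also satisfies the IGPPA inexactness condition $$\big\|(\tilde x,\Lambda(\tilde x))-\mathcal J_{\sigma\mathcal M^{-1}T_\ell}(\bar x,\bar\lambda)\big\|_{\mathcal M}\le\min\Big\{\eta,\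 \delta\,\big\|(\tilde x,\Lambda(\tilde x))-(\bar x,\bar\lambda)\big\|_{\mathcal M}\Big\}.$$ -/

import Mathlib

open scoped RealInnerProductSpace NNReal ENNReal

namespace ProxMultipliers

noncomputable section

/-- `ℝᵏ` (coordinates indexed by `ι`) with its Euclidean norm. -/
abbrev Vec (ι : Type) [Fintype ι] : Type := EuclideanSpace ℝ ι

/-- The linear map `v ↦ B v` given by a matrix. -/
abbrev mv {ι κ : Type} [Fintype ι] [Fintype κ] [DecidableEq κ]
    (B : Matrix ι κ ℝ) (v : Vec κ) : Vec ι :=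
  Matrix.toEuclideanLin B v

/-- The spectral norm of a matrix. -/
def specNorm {ι κ : Type} [Fintype ι] [Fintype κ] [DecidableEq κ] (B : Matrix ι κ ℝ) : ℝ :=
  ‖LinearMap.toContinuousLinearMap (Matrix.toEuclideanLin B)‖

/-- The smallest eigenvalue of a real symmetric matrix (of size at least one). -/
def lambdaMin {ι : Type} [Fintype ι] [DecidableEq ι] (M : Matrix ι ι ℝ) : ℝ :=
  sInf (spectrum ℝ M)

/-- The weighted norm `‖v‖_M = √⟨v, M v⟩`. -/
def wnorm {ι : Type} [Fintype ι] [DecidableEq ι] (M : Matrix ι ι ℝ) (v : Vec ι) : ℝ :=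
  √⟪v, mv M v⟫

/-- Proper, closed (lower semicontinuous) and convex (convex epigraph) functions with values
in `ℝ ∪ {+∞}`. -/
structure ProperClosedConvex {ι : Type} [Fintype ι] (φ : Vec ι → EReal) : Prop where
  ne_bot : ∀ x, φ x ≠ ⊥
  exists_ne_top : ∃ x, φ x ≠ ⊤
  closed : LowerSemicontinuous φ
  convex : Convex ℝ {p : Vec ι × ℝ | φ p.1 ≤ (p.2 : EReal)}

/-- The Fenchel conjugate. -/
def conj {ι : Type} [Fintype ι] (φ : Vec ι → EReal) (v : Vec ι) : EReal :=
  ⨆ u : Vec ι, ((⟪u, v⟫ : ℝ) : EReal) - φ u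

/-- The convex subdifferential. -/
def subdiff {ι : Type} [Fintype ι] (φ : Vec ι → EReal) (x : Vec ι) : Set (Vec ι) :=
  {v | ∀ z, φ x + ((⟪v, z - x⟫ : ℝ) : EReal) ≤ φ z}

/-- The set of global minimizers. -/
def argminSet {α : Type} (φ : α → EReal) : Set α := {x | ∀ z, φ x ≤ φ z}

/-- The set of global maximizers. -/
def argmaxSet {α : Type} (φ : α → EReal) : Set α := {x | ∀ z, φ z ≤ φ x}

/-- The element of a one-point set (an arbitrary point if the set is not a singleton). -/
def pick {α : Type} [Nonempty α] (S : Set α) : α := Classical.epsilon fun x => x ∈ S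

/-- The value at `z` of the multivalued map `(I + σ M⁻¹ T)⁻¹`. -/
def resolventSet {ι : Type} [Fintype ι] [DecidableEq ι] (T : Vec ι → Set (Vec ι))
    (M : Matrix ι ι ℝ) (σ : ℝ) (z : Vec ι) : Set (Vec ι) :=
  {w | ∃ t ∈ T w, w + σ • mv M⁻¹ t = z}

/-- The resolvent `𝒥_{σ M⁻¹ T}` as a single-valued map. -/
def resolventPt {ι : Type} [Fintype ι] [DecidableEq ι] (T : Vec ι → Set (Vec ι))
    (M : Matrix ι ι ℝ) (σ : ℝ) (z : Vec ι) : Vec ι :=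
  pick (resolventSet T M σ z)

/-- The IGPPA inexactness condition for an approximation `w` of `𝒥_{σ M⁻¹ T} z`. -/
def IGPPACond {ι : Type} [Fintype ι] [DecidableEq ι] (T : Vec ι → Set (Vec ι))
    (M : Matrix ι ι ℝ) (σ η δ : ℝ) (z w : Vec ι) : Prop :=
  wnorm M (w - resolventPt T M σ z) ≤ min η (δ * wnorm M (w - z))

/-- The vector `(x, l)` of `ℝⁿ⁺ᵐ`. -/
def pair {n m : ℕ} (x : Vec (Fin n)) (l : Vec (Fin m)) : Vec (Fin n ⊕ Fin m) :=
  WithLp.toLp 2 (Sum.elim x l)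

/-- The first block of a vector of `ℝⁿ⁺ᵐ`. -/
def fstBlock {n m : ℕ} (z : Vec (Fin n ⊕ Fin m)) : Vec (Fin n) :=
  WithLp.toLp 2 fun i => z (Sum.inl i)

/-- The second block of a vector of `ℝⁿ⁺ᵐ`. -/
def sndBlock {n m : ℕ} (z : Vec (Fin n ⊕ Fin m)) : Vec (Fin m) :=
  WithLp.toLp 2 fun j => z (Sum.inr j)

/-- The data of the problem `min f₀(x) + g(x) + h(A x)` and of one proximal step: the constant
`L₀` of `∇f₀`, the blocks `Mˣ`, `M^λ` of the preconditioner, the parameter `σ`, and the base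
point `(x̄, λ̄)`. -/
structure Data (n m : ℕ) where
  A : Matrix (Fin m) (Fin n) ℝ
  f₀ : Vec (Fin n) → ℝ
  L₀ : ℝ≥0
  g : Vec (Fin n) → EReal
  h : Vec (Fin m) → EReal
  Mx : Matrix (Fin n) (Fin n) ℝ
  Ml : Matrix (Fin m) (Fin m) ℝ
  σ : ℝ
  xbar : Vec (Fin n)
  lbar : Vec (Fin m)

namespace Data

variable {n m : ℕ} (D : Data n m)

/-- The preconditioner `M = diag(Mˣ, M^λ)`. -/
def M : Matrix (Fin n ⊕ Fin m) (Fin n ⊕ Fin m) ℝ := Matrix.fromBlocks D.Mx 0 0 D.Ml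

/-- The base point `(x̄, λ̄)`. -/
def zbar : Vec (Fin n ⊕ Fin m) := pair D.xbar D.lbar

/-- The Lagrangian `ℓ(x, λ) = f₀(x) + g(x) + ⟨A x, λ⟩ - h*(λ)`. -/
def lagr (x : Vec (Fin n)) (l : Vec (Fin m)) : EReal :=
  (D.f₀ x : EReal) + D.g x + ((⟪mv D.A x, l⟫ : ℝ) : EReal) - conj D.h l

/-- The multivalued map `T_ℓ(x, λ) = {(v, u) | (v, -u) ∈ ∂ℓ(x, λ)}`, where `(v, w) ∈ ∂ℓ(x, λ)`
means that `v` is a subgradient of `ℓ(·, λ)` at `x` and `w` a supergradient of `ℓ(x, ·)`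
at `λ`. -/
def T (z : Vec (Fin n ⊕ Fin m)) : Set (Vec (Fin n ⊕ Fin m)) :=
  {t | (∀ x', D.lagr (fstBlock z) (sndBlock z)
            + ((⟪fstBlock t, x' - fstBlock z⟫ : ℝ) : EReal) ≤ D.lagr x' (sndBlock z)) ∧
       (∀ l', D.lagr (fstBlock z) l' ≤ D.lagr (fstBlock z) (sndBlock z)
            + ((⟪-sndBlock t, l' - sndBlock z⟫ : ℝ) : EReal))}

/-- The objective `ℓ(x, λ) - ‖λ - λ̄‖²_{M^λ} / (2σ)` of the inner maximization over `λ`. -/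
def dualObj (x : Vec (Fin n)) (l : Vec (Fin m)) : EReal :=
  D.lagr x l - ((1 / (2 * D.σ) * wnorm D.Ml (l - D.lbar) ^ 2 : ℝ) : EReal)

/-- `Λ(x, λ̄, σ)`, the maximizer of the inner objective. -/
def Lam (x : Vec (Fin n)) : Vec (Fin m) := pick (argmaxSet (D.dualObj x))

/-- `F(x) = max_λ {ℓ(x, λ) - ‖λ - λ̄‖²_{M^λ} / (2σ)} + ‖x - x̄‖²_{Mˣ} / (2σ)`. -/
def F (x : Vec (Fin n)) : EReal :=
  (⨆ l : Vec (Fin m), D.dualObj x l)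
    + ((1 / (2 * D.σ) * wnorm D.Mx (x - D.xbar) ^ 2 : ℝ) : EReal)

/-- `F⋆ = min F`. -/
def Fstar : EReal := ⨅ x, D.F x

/-- `ψ(u, λ̄, σ) = max_λ {⟨u, λ⟩ - h*(λ) - ‖λ - λ̄‖²_{M^λ} / (2σ)}`. -/
def psi (u : Vec (Fin m)) : EReal :=
  ⨆ l : Vec (Fin m), ((⟪u, l⟫ : ℝ) : EReal) - conj D.h l
    - ((1 / (2 * D.σ) * wnorm D.Ml (l - D.lbar) ^ 2 : ℝ) : EReal)

/-- The smooth part `f(x) = f₀(x) + ψ(A x, λ̄, σ)` of `F`. -/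
def f (x : Vec (Fin n)) : ℝ := D.f₀ x + (D.psi (mv D.A x)).toReal

/-- The nonsmooth part `φ(x) = g(x) + ‖x - x̄‖²_{Mˣ} / (2σ)` of `F`. -/
def phi (x : Vec (Fin n)) : EReal :=
  D.g x + ((1 / (2 * D.σ) * wnorm D.Mx (x - D.xbar) ^ 2 : ℝ) : EReal)

/-- `L = L₀ + σ ‖A‖² / λ_min(M^λ)`. -/
def L : ℝ := D.L₀ + D.σ / lambdaMin D.Ml * specNorm D.A ^ 2

/-- The objective `(L/2) ‖y - (x - ∇f(x)/L)‖² + φ(y)` of the proximal gradient step at `x`. -/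
def proxGradObj (x y : Vec (Fin n)) : EReal :=
  ((D.L / 2 * ‖y - (x - (1 / D.L) • gradient D.f x)‖ ^ 2 : ℝ) : EReal) + D.phi y

/-- The proximal gradient operator `𝒢_F`. -/
def G (x : Vec (Fin n)) : Vec (Fin n) := pick (argminSet (D.proxGradObj x))

/-- The computable stopping criterion
`dist(0, ∂F(x)) ≤ (√λ_min(Mˣ) / σ) min {η, δ ‖(x, Λ(x)) - (x̄, λ̄)‖_M}`;
the distance to the empty set is `+∞`. -/
def StopCrit (η δ : ℝ) (x : Vec (Fin n)) : Prop :=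
  Metric.infEDist 0 (subdiff D.F x) ≤
    ENNReal.ofReal (√(lambdaMin D.Mx) / D.σ *
      min η (δ * wnorm D.M (pair x (D.Lam x) - D.zbar)))

/-- All objects attached to the proximal step are genuinely defined: `Λ(x)` is the unique
maximizer for `x ∈ dom g`, `ψ` is finite, `f` is differentiable, `F = f + φ`, `F` has a unique
minimizer and `F⋆` is finite, `𝒢_F` is the unique minimizer of its objective, and the resolvent
of `T_ℓ` is single-valued and everywhere defined. -/
structure WellPosed : Prop where
  lam : ∀ x, D.g x ≠ ⊤ → argmaxSet (D.dualObj x) = {D.Lam x}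
  psi_finite : ∀ u, D.psi u ≠ ⊥ ∧ D.psi u ≠ ⊤
  f_diff : Differentiable ℝ D.f
  decomp : ∀ x, D.F x = (D.f x : EReal) + D.phi x
  minimizer : ∃ xstar, argminSet D.F = {xstar}
  fstar_finite : D.Fstar ≠ ⊥ ∧ D.Fstar ≠ ⊤
  proxGrad : ∀ x, argminSet (D.proxGradObj x) = {D.G x}
  resolvent : ∀ z, resolventSet D.T D.M D.σ z = {resolventPt D.T D.M D.σ z}

end Data

end

end ProxMultipliers

/-! Maximizing out `λ` leaves `F = g + (f + quad)`, where `g` is closed convex and `f + quad` is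
smooth and strongly convex. The inner maximizer is the proximal point of `h*`, hence Lipschitz in `A
x` with constant `σ / λ_min(M^λ)`, and it is a subgradient of `ψ`. A Lipschitz selection of
subgradients is a gradient, so `f` is differentiable with `L`-Lipschitz gradient. The sum rule
`mem_subdiff_add` and strong convexity give existence and uniqueness of the minimizers.

Stopping criterion implies inexactness: if `s ∈ ∂F(x)`, then `w = (x, Λ(x))` satisfies the resolvent
inclusion up to the error `(s, 0)`; the dual block has no error because `Λ(x)` is exact. Comparing
with the exact point `w'` through monotonicity of `T_ℓ` gives `‖w - w'‖_M² ≤ σ ⟨s, x - x'⟩`, hence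
`‖w - w'‖_M ≤ σ ‖s‖ / √λ_min(Mˣ)` (`wnorm_sub_resolventPt_le`). The same inclusion with `s = 0`
produces the resolvent from the minimizer of `F`.

Small gap implies stopping criterion: the proximal gradient step yields an explicit `s ∈ ∂F(𝒢_F(y))`
with `‖s‖² ≤ 2 L² ‖y - 𝒢_F(y)‖² ≤ 4 L (F(y) - F⋆)`, which settles the bound by `η`. For the bound by
`δ`, the gap at `𝒢_F(x̄)` is at most `(L/2) ‖x⋆ - x̄‖²`, so the scaled residual `R` is at most
`δ/(1+δ)` times the distance from `(x̄, λ̄)` to the exact proximal point. A triangle inequality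
moves that distance to the computed point and absorbs the factor `1 + δ`. -/

namespace ProxMultipliers

/-! ### Differentiable convex functions and quadratic growth. -/

section ConvexAnalysis

variable {ι : Type} [Fintype ι]

/-- `Q` has gradient `q` and lies above its tangents by at least `c / 2 ‖z - x‖²`. -/
structure GradConvex (c : ℝ) (Q : Vec ι → ℝ) (q : Vec ι → Vec ι) : Prop where
  grad : ∀ x, HasGradientAt Q (q x) x
  le : ∀ x z, Q x + ⟪q x, z - x⟫ + c / 2 * ‖z - x‖ ^ 2 ≤ Q z

theorem HasGradientAt.hasDerivAt_line {Q : Vec ι → ℝ} {q x d : Vec ι} {t : ℝ}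
    (h : HasGradientAt Q q (x + t • d)) :
    HasDerivAt (fun s : ℝ => Q (x + s • d)) ⟪q, d⟫ t := by
  have h1 : HasDerivAt (fun s : ℝ => x + s • d) d t := by
    simpa using ((hasDerivAt_id t).smul_const d).const_add x
  have h2 := h.hasFDerivAt.comp_hasDerivAt t h1
  rw [InnerProductSpace.toDual_apply_apply] at h2
  exact h2

theorem HasGradientAt.le_inner_of_line {Q : Vec ι → ℝ} {q x d : Vec ι} {r : ℝ}
    (h : HasGradientAt Q q x) (hr : ∀ t : ℝ, 0 < t → t ≤ 1 → Q x + t * r ≤ Q (x + t • d)) :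
    r ≤ ⟪q, d⟫ := by
  have h0 : HasGradientAt Q q (x + (0 : ℝ) • d) := by simpa using h
  have h1 := (HasGradientAt.hasDerivAt_line h0).tendsto_slope_zero_right
  refine ge_of_tendsto h1 ?_
  filter_upwards [Ioc_mem_nhdsGT (zero_lt_one' ℝ)] with t ht
  have := hr t ht.1 ht.2
  simp only [zero_add, zero_smul, add_zero, smul_eq_mul]
  rw [inv_mul_eq_div, le_div_iff₀ ht.1]
  linarith

theorem GradConvex.of_convexOn {Q : Vec ι → ℝ} (hc : ConvexOn ℝ Set.univ Q)
    (hd : Differentiable ℝ Q) : GradConvex 0 Q (gradient Q) where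
  grad x := (hd x).hasGradientAt
  le x z := by
    have h : HasGradientAt (fun y => -Q y) (-gradient Q x) x := by
      have := (hd x).hasGradientAt.hasFDerivAt.neg
      rw [hasGradientAt_iff_hasFDerivAt, map_neg]
      exact this
    have := HasGradientAt.le_inner_of_line (d := z - x) (r := Q x - Q z) h (fun t h0 h1 => by
      have := hc.2 (Set.mem_univ x) (Set.mem_univ z) (sub_nonneg.2 h1) h0.le (by ring)
      have e : (1 - t) • x + t • z = x + t • (z - x) := by module
      rw [e] at this
      simp only [smul_eq_mul] at this
      linarith)
    rw [inner_neg_left] at this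
    linarith

theorem GradConvex.add {c c' : ℝ} {Q Q' : Vec ι → ℝ} {q q' : Vec ι → Vec ι}
    (h : GradConvex c Q q) (h' : GradConvex c' Q' q') :
    GradConvex (c + c') (fun x => Q x + Q' x) (fun x => q x + q' x) where
  grad x := by
    have := (h.grad x).hasFDerivAt.add (h'.grad x).hasFDerivAt
    rw [hasGradientAt_iff_hasFDerivAt, map_add]
    exact this
  le x z := by
    have h1 := h.le x z
    have h2 := h'.le x z
    rw [inner_add_left]
    linarith

theorem GradConvex.affine (a : Vec ι) (b : ℝ) :
    GradConvex 0 (fun x => ⟪a, x⟫ + b) (fun _ => a) where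
  grad x := by
    rw [hasGradientAt_iff_hasFDerivAt]
    have := ((InnerProductSpace.toDual ℝ (Vec ι) a).hasFDerivAt (x := x)).add_const b
    simpa using this
  le x z := by
    rw [inner_sub_right]
    linarith

theorem GradConvex.continuous {c : ℝ} {Q : Vec ι → ℝ} {q : Vec ι → Vec ι}
    (h : GradConvex c Q q) : Continuous Q :=
  continuous_iff_continuousAt.2 fun x => (h.grad x).continuousAt

theorem GradConvex.monotone {c : ℝ} {Q : Vec ι → ℝ} {q : Vec ι → Vec ι}
    (h : GradConvex c Q q) (x z : Vec ι) : c * ‖z - x‖ ^ 2 ≤ ⟪q z - q x, z - x⟫ := by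
  have h1 := h.le x z
  have h2 := h.le z x
  rw [inner_sub_left]
  rw [← neg_sub z x, inner_neg_right, norm_neg] at h2
  linarith

theorem hasGradientAt_of_abs_le {Q : Vec ι → ℝ} {x q : Vec ι} {C : ℝ}
    (h : ∀ z, |Q z - Q x - ⟪q, z - x⟫| ≤ C * ‖z - x‖ ^ 2) : HasGradientAt Q q x := by
  rw [hasGradientAt_iff_isLittleO]
  refine Asymptotics.IsBigO.trans_isLittleO (g := fun z => ‖z - x‖ ^ 2) ?_ ?_
  · refine Asymptotics.IsBigO.of_bound C (Filter.Eventually.of_forall fun z => ?_)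
    simpa using h z
  · have h1 : (fun z => ‖z - x‖ ^ 2) =o[nhds x] fun z => ‖z - x‖ := by
      have : Filter.Tendsto (fun z => ‖z - x‖) (nhds x) (nhds 0) := by
        have : Continuous fun z : Vec ι => ‖z - x‖ := by fun_prop
        simpa using this.tendsto x
      have h2 := ((Asymptotics.isLittleO_one_iff ℝ).2 this).mul_isBigO
        (Asymptotics.isBigO_refl (fun z => ‖z - x‖) (nhds x))
      simpa [pow_two] using h2
    exact h1.of_norm_right

/-- The subgradient inequalities at `x` and at `z` trap the remainder `Q z - Q x - ⟪q x, z - x⟫`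
between `0` and `⟪q z - q x, z - x⟫`, which is quadratically small. This yields differentiability of
`f` without a separate envelope theorem. -/
theorem GradConvex.of_lipschitz {Q : Vec ι → ℝ} {q : Vec ι → Vec ι} {C : ℝ}
    (h : ∀ x z, Q x + ⟪q x, z - x⟫ ≤ Q z) (hq : ∀ x z, ‖q z - q x‖ ≤ C * ‖z - x‖) :
    GradConvex 0 Q q where
  grad x := by
    refine hasGradientAt_of_abs_le (C := C) fun z => ?_
    have h1 := h x z
    have h2 := h z x
    rw [← neg_sub z x, inner_neg_right] at h2
    rw [abs_of_nonneg (by linarith)]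
    calc Q z - Q x - ⟪q x, z - x⟫ ≤ ⟪q z - q x, z - x⟫ := by
          rw [inner_sub_left]
          linarith
      _ ≤ ‖q z - q x‖ * ‖z - x‖ := real_inner_le_norm _ _
      _ ≤ C * ‖z - x‖ * ‖z - x‖ := by gcongr; exact hq x z
      _ = C * ‖z - x‖ ^ 2 := by ring
  le x z := by linarith [h x z]

theorem gradConvex_norm_sq (c : ℝ) (a : Vec ι) :
    GradConvex c (fun x => c / 2 * ‖x - a‖ ^ 2) (fun x => c • (x - a)) := by
  have key : ∀ x z : Vec ι, c / 2 * ‖z - a‖ ^ 2 - c / 2 * ‖x - a‖ ^ 2 - ⟪c • (x - a), z - x⟫ =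
      c / 2 * ‖z - x‖ ^ 2 := by
    intro x z
    have e : z - a = (x - a) + (z - x) := by abel
    rw [e, norm_add_sq_real, real_inner_smul_left]
    ring
  refine ⟨fun x => hasGradientAt_of_abs_le (C := |c / 2|) fun z => ?_, fun x z => ?_⟩
  · rw [key, abs_mul, abs_of_nonneg (sq_nonneg ‖z - x‖)]
  · linarith [key x z]

/-- The descent lemma. -/
theorem le_of_lipschitz_gradient {Q : Vec ι → ℝ} {q : Vec ι → Vec ι} {L : ℝ}
    (hq : ∀ x, HasGradientAt Q (q x) x) (hL : ∀ x z, ‖q z - q x‖ ≤ L * ‖z - x‖) (x z : Vec ι) :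
    Q z ≤ Q x + ⟪q x, z - x⟫ + L / 2 * ‖z - x‖ ^ 2 := by
  set d := z - x with hd
  -- The gap between `Q` on the segment and its quadratic upper model is antitone; comparing `t = 0`
  -- with `t = 1` gives the claim.
  let G : ℝ → ℝ := fun t => Q (x + t • d) - (t * ⟪q x, d⟫ + L / 2 * ‖d‖ ^ 2 * t ^ 2)
  have hG : ∀ t, HasDerivAt G (⟪q (x + t • d), d⟫ - (⟪q x, d⟫ + L * ‖d‖ ^ 2 * t)) t := by
    intro t
    have h1 := HasGradientAt.hasDerivAt_line (x := x) (d := d) (t := t) (hq _)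
    have h2 : HasDerivAt (fun t : ℝ => t * ⟪q x, d⟫ + L / 2 * ‖d‖ ^ 2 * t ^ 2)
        (⟪q x, d⟫ + L * ‖d‖ ^ 2 * t) t := by
      have := ((hasDerivAt_id t).mul_const ⟪q x, d⟫).add
        (((hasDerivAt_id t).pow 2).const_mul (L / 2 * ‖d‖ ^ 2))
      refine this.congr_deriv ?_
      simp
      ring
    exact h1.sub h2
  have hanti : AntitoneOn G (Set.Icc 0 1) := by
    refine antitoneOn_of_deriv_nonpos (convex_Icc 0 1)
      (fun t _ => (hG t).continuousAt.continuousWithinAt)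
      (fun t _ => (hG t).differentiableAt.differentiableWithinAt) fun t ht => ?_
    rw [interior_Icc] at ht
    rw [(hG t).deriv]
    have h1 : ⟪q (x + t • d) - q x, d⟫ ≤ ‖q (x + t • d) - q x‖ * ‖d‖ := real_inner_le_norm _ _
    have h2 := hL x (x + t • d)
    rw [add_sub_cancel_left, norm_smul, Real.norm_of_nonneg ht.1.le] at h2
    rw [inner_sub_left] at h1
    nlinarith [norm_nonneg d]
  have := hanti (Set.left_mem_Icc.2 zero_le_one) (Set.right_mem_Icc.2 zero_le_one) zero_le_one
  simp only [G, one_smul, zero_smul, add_zero, hd, add_sub_cancel] at this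
  linarith

theorem le_of_mem_subdiff {k : Vec ι → EReal} {v x z : Vec ι} (h : v ∈ subdiff k x) {a b : ℝ}
    (ha : k x = a) (hb : k z = b) : a + ⟪v, z - x⟫ ≤ b := by
  have := h z
  rwa [ha, hb, ← EReal.coe_add, EReal.coe_le_coe_iff] at this

theorem GradConvex.growth {k : Vec ι → EReal} {c : ℝ} {Q : Vec ι → ℝ} {q : Vec ι → Vec ι}
    (hQ : GradConvex c Q q) {x z : Vec ι}
    (hx : -q x ∈ subdiff k x) {a b : ℝ} (ha : k x = a) (hb : k z = b) :
    a + Q x + c / 2 * ‖z - x‖ ^ 2 ≤ b + Q z := by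
  have h1 := le_of_mem_subdiff hx ha hb
  have h2 := hQ.le x z
  rw [inner_neg_left] at h1
  linarith

/-! ### Closed convex functions: conjugates, sum rule, minimizers. -/

namespace ProperClosedConvex

variable {k : Vec ι → EReal}

theorem exists_coe (hk : ProperClosedConvex k) {x : Vec ι} (hx : k x ≠ ⊤) :
    ∃ a : ℝ, k x = a :=
  ⟨(k x).toReal, (EReal.coe_toReal hx (hk.ne_bot x)).symm⟩

theorem exists_real (hk : ProperClosedConvex k) : ∃ x, ∃ a : ℝ, k x = a := by
  obtain ⟨x, hx⟩ := hk.exists_ne_top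
  exact ⟨x, hk.exists_coe hx⟩

theorem le_line (hk : ProperClosedConvex k) {x z : Vec ι} {a b t : ℝ} (ha : k x = a)
    (hb : k z = b) (h0 : 0 ≤ t) (h1 : t ≤ 1) :
    k (x + t • (z - x)) ≤ ((a + t * (b - a) : ℝ) : EReal) := by
  have := hk.convex (x := (x, a)) (y := (z, b)) ha.le hb.le (sub_nonneg.2 h1) h0 (by ring)
  have e : (1 - t) • x + t • z = x + t • (z - x) := by module
  have e' : (1 - t) • a + t • b = a + t * (b - a) := by simp only [smul_eq_mul]; ring
  simp only [Set.mem_ofPred_eq, Prod.smul_mk, Prod.mk_add_mk, e, e'] at this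
  exact this

/-- Separate a point strictly below the graph from the closed convex epigraph. Since that point lies
under a point of the graph, the separating functional has positive vertical component, so it can be
solved for the height. -/
theorem exists_affine_le (hk : ProperClosedConvex k) :
    ∃ (a : Vec ι) (b : ℝ), ∀ x, ((⟪a, x⟫ + b : ℝ) : EReal) ≤ k x := by
  obtain ⟨x₀, r₀, h₀⟩ := hk.exists_real
  have hcl : IsClosed {p : Vec ι × ℝ | k p.1 ≤ (p.2 : EReal)} :=
    hk.closed.isClosed_epigraph.preimage
      (continuous_fst.prodMk (continuous_coe_real_ereal.comp continuous_snd))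
  have hnot : (x₀, r₀ - 1) ∉ {p : Vec ι × ℝ | k p.1 ≤ (p.2 : EReal)} := by
    simp only [Set.mem_ofPred_eq, h₀, EReal.coe_le_coe_iff]
    linarith
  obtain ⟨f, u, hu, hf⟩ := geometric_hahn_banach_point_closed hk.convex hcl hnot
  have hsplit : ∀ x r, f (x, r) = f (x, 0) + r * f (0, 1) := by
    intro x r
    have : ((x, r) : Vec ι × ℝ) = (x, 0) + r • (0, 1) := by simp
    rw [this, map_add, map_smul, smul_eq_mul]
  have hs : 0 < f (0, 1) := by
    have := hf (x₀, r₀) h₀.le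
    rw [hsplit] at this hu
    nlinarith
  let a := (InnerProductSpace.toDual ℝ (Vec ι)).symm
    (f.comp (ContinuousLinearMap.inl ℝ (Vec ι) ℝ))
  have ha : ∀ x, ⟪a, x⟫ = f (x, 0) := fun x => by
    simp [a]
  refine ⟨-(f (0, 1))⁻¹ • a, u / f (0, 1), fun x => ?_⟩
  by_cases hx : k x = ⊤
  · simp [hx]
  obtain ⟨r, hr⟩ := hk.exists_coe hx
  have := hf (x, r) hr.le
  rw [hsplit] at this
  rw [hr, EReal.coe_le_coe_iff, real_inner_smul_left, ha]
  have h3 : -(f (0, 1))⁻¹ * f (x, 0) + u / f (0, 1) = (u - f (x, 0)) / f (0, 1) := by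
    field_simp
    ring
  rw [h3, div_le_iff₀ hs]
  linarith

theorem conj (hk : ProperClosedConvex k) : ProperClosedConvex (conj k) where
  ne_bot v := by
    obtain ⟨x, a, ha⟩ := hk.exists_real
    have : ((⟪x, v⟫ : ℝ) : EReal) - k x ≤ ProxMultipliers.conj k v :=
      le_iSup (fun u : Vec ι => ((⟪u, v⟫ : ℝ) : EReal) - k u) x
    rw [ha, ← EReal.coe_sub] at this
    exact ((EReal.bot_lt_coe _).trans_le this).ne'
  exists_ne_top := by
    obtain ⟨a, b, hab⟩ := hk.exists_affine_le
    refine ⟨a, ?_⟩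
    have : ProxMultipliers.conj k a ≤ ((-b : ℝ) : EReal) := by
      refine iSup_le fun u => ?_
      by_cases hu : k u = ⊤
      · simp [hu]
      obtain ⟨r, hr⟩ := hk.exists_coe hu
      have := hab u
      rw [hr, EReal.coe_le_coe_iff, real_inner_comm] at this
      rw [hr, ← EReal.coe_sub, EReal.coe_le_coe_iff]
      linarith
    exact (this.trans_lt (EReal.coe_lt_top _)).ne
  closed := by
    refine lowerSemicontinuous_iSup fun u => Continuous.lowerSemicontinuous ?_
    by_cases hu : k u = ⊤
    · simp [hu, continuous_const]
    obtain ⟨r, hr⟩ := hk.exists_coe hu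
    simp only [hr, ← EReal.coe_sub]
    exact continuous_coe_real_ereal.comp (by fun_prop)
  convex := by
    have : {p : Vec ι × ℝ | ProxMultipliers.conj k p.1 ≤ (p.2 : EReal)} =
        ⋂ u, {p : Vec ι × ℝ | ((⟪u, p.1⟫ : ℝ) : EReal) - k u ≤ (p.2 : EReal)} := by
      ext p
      simp [ProxMultipliers.conj]
    rw [this]
    refine convex_iInter fun u => ?_
    by_cases hu : k u = ⊤
    · simp [hu, convex_univ]
    obtain ⟨r, hr⟩ := hk.exists_coe hu
    simp only [hr, ← EReal.coe_sub, EReal.coe_le_coe_iff]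
    intro p hp p' hp' s t hs ht hst
    simp only [Set.mem_ofPred_eq, Prod.fst_add, Prod.smul_fst, Prod.snd_add, Prod.smul_snd,
      inner_add_right, real_inner_smul_right, smul_eq_mul] at *
    have : t = 1 - s := by linarith
    subst this
    nlinarith

variable {c : ℝ} {Q : Vec ι → ℝ} {q : Vec ι → Vec ι}

/-- No constraint qualification is needed because `Q` is differentiable everywhere: along a segment
`k` lies below its chord, so the difference quotient of `Q` carries the inequality to the limit. -/
theorem mem_subdiff_add (hk : ProperClosedConvex k) (hQ : GradConvex c Q q) (hc : 0 ≤ c)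
    {v x : Vec ι} : v ∈ subdiff (fun z => k z + (Q z : EReal)) x ↔ v - q x ∈ subdiff k x := by
  obtain ⟨x₀, a₀, h₀⟩ := hk.exists_real
  have key : ∀ {z}, ∀ b : ℝ, k z = b → ∀ a : ℝ, k x = a →
      ((k x + ((⟪v - q x, z - x⟫ : ℝ) : EReal) ≤ k z) ↔ a + ⟪v - q x, z - x⟫ ≤ b) := by
    intro z b hb a ha
    rw [ha, hb, ← EReal.coe_add, EReal.coe_le_coe_iff]
  constructor
  · intro h
    have hx : k x ≠ ⊤ := by
      intro hx
      have := h x₀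
      simp [hx, h₀, ← EReal.coe_add] at this
    obtain ⟨a, ha⟩ := hk.exists_coe hx
    intro z
    by_cases hz : k z = ⊤
    · simp [hz]
    obtain ⟨b, hb⟩ := hk.exists_coe hz
    rw [key b hb a ha]
    have := HasGradientAt.le_inner_of_line (d := z - x) (r := ⟪v, z - x⟫ - (b - a)) (hQ.grad x)
      (fun t h0 h1 => by
        have h2 := hk.le_line ha hb h0.le h1
        have h3 := (h (x + t • (z - x))).trans (add_le_add_left h2 _)
        simp only [ha, ← EReal.coe_add, EReal.coe_le_coe_iff, add_sub_cancel_left,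
          real_inner_smul_right] at h3
        linarith)
    rw [inner_sub_left]
    linarith
  · intro h
    have hx : k x ≠ ⊤ := by
      intro hx
      have := h x₀
      simp [hx, h₀] at this
    obtain ⟨a, ha⟩ := hk.exists_coe hx
    intro z
    by_cases hz : k z = ⊤
    · simp [hz]
    obtain ⟨b, hb⟩ := hk.exists_coe hz
    have h1 := (key b hb a ha).1 (h z)
    simp only [ha, hb, ← EReal.coe_add, EReal.coe_le_coe_iff]
    have := hQ.le x z
    rw [inner_sub_left] at h1
    nlinarith [sq_nonneg ‖z - x‖]

theorem ne_top_of_mem_subdiff (hk : ProperClosedConvex k) {v x : Vec ι} (h : v ∈ subdiff k x) :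
    k x ≠ ⊤ := by
  obtain ⟨x₀, a₀, h₀⟩ := hk.exists_real
  intro hx
  have := h x₀
  simp [hx, h₀] at this

theorem subdiff_monotone (hk : ProperClosedConvex k) {v v' x x' : Vec ι} (h : v ∈ subdiff k x)
    (h' : v' ∈ subdiff k x') : 0 ≤ ⟪v' - v, x' - x⟫ := by
  obtain ⟨a, ha⟩ := hk.exists_coe (hk.ne_top_of_mem_subdiff h)
  obtain ⟨a', ha'⟩ := hk.exists_coe (hk.ne_top_of_mem_subdiff h')
  have h1 := le_of_mem_subdiff h ha ha'
  have h2 := le_of_mem_subdiff h' ha' ha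
  rw [← neg_sub x' x, inner_neg_right] at h2
  rw [inner_sub_left]
  linarith

theorem mem_argminSet_iff (hk : ProperClosedConvex k) (hQ : GradConvex c Q q) (hc : 0 ≤ c)
    {x : Vec ι} : x ∈ argminSet (fun z => k z + (Q z : EReal)) ↔ -q x ∈ subdiff k x := by
  rw [← zero_sub, ← hk.mem_subdiff_add hQ hc]
  simp [argminSet, subdiff]

/-- An affine minorant of `k` plus the quadratic growth of `Q` makes the sum coercive, so the search
reduces to a compact ball, where lower semicontinuity suffices. -/
theorem argminSet_nonempty (hk : ProperClosedConvex k) (hQ : GradConvex c Q q) (hc : 0 < c) :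
    (argminSet (fun z => k z + (Q z : EReal))).Nonempty := by
  obtain ⟨x₀, a₀, h₀⟩ := hk.exists_real
  obtain ⟨v, b, hab⟩ := hk.exists_affine_le
  have hlsc : LowerSemicontinuous (fun z => k z + (Q z : EReal)) := by
    refine hk.closed.add' (continuous_coe_real_ereal.comp hQ.continuous).lowerSemicontinuous
      fun x => ?_
    exact EReal.continuousAt_add (Or.inr (EReal.coe_ne_bot _)) (Or.inr (EReal.coe_ne_top _))
  -- Outside the ball of radius `R` the values exceed the one at `x₀`.
  obtain ⟨R, hR⟩ : ∃ R : ℝ, ∀ z, k z + (Q z : EReal) ≤ k x₀ + (Q x₀ : EReal) → ‖z‖ ≤ R := by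
    set B := ‖v + q 0‖
    set C := a₀ + Q x₀ - b - Q 0
    -- Beyond this radius both `c / 2 * ‖z‖ > B + 1` and `‖z‖ > |C|` hold, which contradicts `c / 2
    -- * ‖z‖ ^ 2 ≤ C + B * ‖z‖`.
    refine ⟨2 * B / c + |C| + 2 / c, fun z hz => ?_⟩
    have hz' := (add_le_add_left (hab z) (Q z : EReal)).trans hz
    rw [h₀, ← EReal.coe_add, ← EReal.coe_add, EReal.coe_le_coe_iff] at hz'
    have h1 := hQ.le 0 z
    have h2 : -(B * ‖z‖) ≤ ⟪v + q 0, z⟫ := (abs_le.1 (abs_real_inner_le_norm _ _)).1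
    rw [inner_add_left] at h2
    simp only [sub_zero] at h1
    have h3 : c / 2 * ‖z‖ ^ 2 ≤ C + B * ‖z‖ := by
      simp only [C]
      linarith
    by_contra hlt
    push Not at hlt
    have hB : 0 ≤ B := norm_nonneg _
    have h5 : c / 2 * (2 * B / c + |C| + 2 / c) = B + c / 2 * |C| + 1 := by
      field_simp
    have h6 : B + c / 2 * |C| + 1 < c / 2 * ‖z‖ := by
      rw [← h5]
      exact mul_lt_mul_of_pos_left hlt (by positivity)
    have h8 : |C| < ‖z‖ := by
      have : 0 ≤ 2 * B / c + 2 / c := by positivity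
      linarith
    have h9 : (B + 1) * ‖z‖ ≤ c / 2 * ‖z‖ * ‖z‖ := by
      refine mul_le_mul_of_nonneg_right ?_ (norm_nonneg z)
      nlinarith [abs_nonneg C]
    nlinarith [le_abs_self C]
  obtain ⟨p, -, hp⟩ := LowerSemicontinuousOn.exists_isMinOn (s := Metric.closedBall 0 R)
    ⟨x₀, by simpa using hR x₀ le_rfl⟩ (isCompact_closedBall 0 R)
    (hlsc.lowerSemicontinuousOn _)
  refine ⟨p, fun z => ?_⟩
  by_cases hz : ‖z‖ ≤ R
  · exact hp (by simpa using hz)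
  · have h1 := hp (show x₀ ∈ Metric.closedBall 0 R by simpa using hR x₀ le_rfl)
    exact h1.trans (le_of_not_ge fun h => hz (hR z h))

theorem exists_argminSet_eq_singleton (hk : ProperClosedConvex k) (hQ : GradConvex c Q q)
    (hc : 0 < c) : ∃ p, argminSet (fun z => k z + (Q z : EReal)) = {p} := by
  obtain ⟨p, hp⟩ := hk.argminSet_nonempty hQ hc
  refine ⟨p, Set.Subset.antisymm (fun z hz => ?_) (Set.singleton_subset_iff.2 hp)⟩
  rw [hk.mem_argminSet_iff hQ hc.le] at hp hz
  have h1 := hk.subdiff_monotone hp hz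
  have h2 := hQ.monotone p z
  rw [neg_sub_neg, ← neg_sub, inner_neg_left] at h1
  have h3 : ‖z - p‖ ^ 2 ≤ 0 := by nlinarith
  have h4 : ‖z - p‖ = 0 := pow_eq_zero_iff two_ne_zero |>.1 (le_antisymm h3 (sq_nonneg _))
  simpa [sub_eq_zero] using h4

end ProperClosedConvex

theorem pick_mem {α : Type} [Nonempty α] {S : Set α} (h : S.Nonempty) : pick S ∈ S :=
  Classical.epsilon_spec h

theorem pick_singleton {α : Type} [Nonempty α] {S : Set α} {p : α} (h : S = {p}) :
    pick S = p := by
  have := pick_mem (S := S) (h ▸ Set.singleton_nonempty p)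
  rwa [h, Set.mem_singleton_iff, ← h] at this

theorem iSup_eq_of_mem_argmaxSet {α : Type} {φ : α → EReal} {p : α} (h : p ∈ argmaxSet φ) :
    ⨆ x, φ x = φ p :=
  le_antisymm (iSup_le h) (le_iSup φ p)

theorem iInf_eq_of_mem_argminSet {α : Type} {φ : α → EReal} {p : α} (h : p ∈ argminSet φ) :
    ⨅ x, φ x = φ p :=
  le_antisymm (iInf_le φ p) (le_iInf h)

end ConvexAnalysis

end ProxMultipliers

namespace ProxMultipliers

/-! ### Matrices, weighted norms and the smallest eigenvalue. -/

section Matrices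

variable {ι κ : Type} [Fintype ι] [Fintype κ] [DecidableEq κ]

theorem norm_mv_le (B : Matrix ι κ ℝ) (x : Vec κ) : ‖mv B x‖ ≤ specNorm B * ‖x‖ :=
  (LinearMap.toContinuousLinearMap (Matrix.toEuclideanLin B)).le_opNorm x

theorem specNorm_nonneg (B : Matrix ι κ ℝ) : 0 ≤ specNorm B := norm_nonneg _

variable [DecidableEq ι]

theorem inner_mv_transpose (B : Matrix ι κ ℝ) (x : Vec κ) (l : Vec ι) :
    ⟪mv B x, l⟫ = ⟪x, mv B.transpose l⟫ := by
  have h := Matrix.toEuclideanLin_conjTranspose_eq_adjoint B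
  rw [Matrix.conjTranspose_eq_transpose_of_trivial] at h
  simp only [mv, h]
  exact (LinearMap.adjoint_inner_right _ _ _).symm

theorem inner_mv_comm {B : Matrix ι ι ℝ} (hB : B.IsHermitian) (x y : Vec ι) :
    ⟪mv B x, y⟫ = ⟪x, mv B y⟫ := by
  have h : B.transpose = B := by
    rw [← Matrix.conjTranspose_eq_transpose_of_trivial]
    exact hB
  rw [inner_mv_transpose, h]

theorem norm_mv_transpose_le (B : Matrix ι κ ℝ) (l : Vec ι) :
    ‖mv B.transpose l‖ ≤ specNorm B * ‖l‖ := by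
  set w := mv B.transpose l with hw
  have h1 : ‖w‖ * ‖w‖ ≤ specNorm B * ‖l‖ * ‖w‖ := by
    rw [← real_inner_self_eq_norm_mul_norm]
    nth_rw 2 [hw]
    rw [← inner_mv_transpose]
    calc ⟪mv B w, l⟫ ≤ ‖mv B w‖ * ‖l‖ := real_inner_le_norm _ _
      _ ≤ specNorm B * ‖w‖ * ‖l‖ := by gcongr; exact norm_mv_le B w
      _ = _ := by ring
  rcases (norm_nonneg w).eq_or_lt with h | h
  · rw [← h]
    exact mul_nonneg (specNorm_nonneg B) (norm_nonneg l)
  · exact le_of_mul_le_mul_right h1 h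

theorem inner_mv_nonneg {M : Matrix ι ι ℝ} (hM : M.PosSemidef) (v : Vec ι) :
    0 ≤ ⟪v, mv M v⟫ := by
  have := hM.dotProduct_mulVec_nonneg v.ofLp
  simpa [mv, PiLp.inner_apply, dotProduct, mul_comm] using this

theorem wnorm_sq {M : Matrix ι ι ℝ} (hM : M.PosSemidef) (v : Vec ι) :
    wnorm M v ^ 2 = ⟪v, mv M v⟫ :=
  Real.sq_sqrt (inner_mv_nonneg hM v)

theorem wnorm_nonneg (M : Matrix ι ι ℝ) (v : Vec ι) : 0 ≤ wnorm M v := Real.sqrt_nonneg _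

-- Factoring `M = Bᵀ B` turns the weighted norm into `‖B v‖`.
open scoped MatrixOrder in
theorem wnorm_add_le {M : Matrix ι ι ℝ} (hM : M.PosSemidef) (v w : Vec ι) :
    wnorm M (v + w) ≤ wnorm M v + wnorm M w := by
  obtain ⟨B, hB⟩ := CStarAlgebra.nonneg_iff_eq_star_mul_self.1 hM.nonneg
  have h : ∀ u : Vec ι, wnorm M u = ‖mv B u‖ := by
    intro u
    have h1 : ⟪u, mv M u⟫ = ‖mv B u‖ ^ 2 := by
      rw [← real_inner_self_eq_norm_sq, inner_mv_transpose, hB, Matrix.star_eq_conjTranspose,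
        Matrix.conjTranspose_eq_transpose_of_trivial]
      simp [mv]
    rw [wnorm, h1, Real.sqrt_sq (norm_nonneg _)]
  simp only [h, mv, map_add]
  exact norm_add_le _ _

/-- Subtracting `lambdaMin M` times the identity shifts the spectrum into the nonnegative reals. -/
theorem lambdaMin_mul_norm_sq_le {M : Matrix ι ι ℝ} (hM : M.IsHermitian) (v : Vec ι) :
    lambdaMin M * ‖v‖ ^ 2 ≤ ⟪v, mv M v⟫ := by
  have hfin : (spectrum ℝ M).Finite := by
    rw [hM.spectrum_real_eq_range_eigenvalues]
    exact Set.finite_range _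
  have hps : (M - algebraMap ℝ (Matrix ι ι ℝ) (lambdaMin M)).PosSemidef := by
    refine Matrix.posSemidef_iff_isHermitian_and_spectrum_nonneg.2 ⟨?_, ?_⟩
    · refine hM.sub ?_
      rw [Matrix.algebraMap_eq_diagonal]
      exact Matrix.isHermitian_diagonal _
    · rw [← spectrum.sub_singleton_eq]
      rintro _ ⟨a, ha, b, hb, rfl⟩
      rw [Set.mem_singleton_iff] at hb
      subst hb
      exact sub_nonneg.2 (csInf_le hfin.bddBelow ha)
  have h := inner_mv_nonneg hps v
  rw [Algebra.algebraMap_eq_smul_one] at h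
  simp only [mv, map_sub, map_smul, LinearMap.sub_apply, LinearMap.smul_apply, inner_sub_right,
    Matrix.toLpLin_one, LinearMap.id_apply, real_inner_smul_right, real_inner_self_eq_norm_sq] at h
  linarith

theorem lambdaMin_pos [Nonempty ι] {M : Matrix ι ι ℝ} (hM : M.PosDef) : 0 < lambdaMin M := by
  have h : lambdaMin M ∈ spectrum ℝ M := by
    unfold lambdaMin
    rw [hM.isHermitian.spectrum_real_eq_range_eigenvalues]
    exact (Set.range_nonempty _).csInf_mem (Set.finite_range _)
  rw [hM.isHermitian.spectrum_real_eq_range_eigenvalues] at h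
  obtain ⟨i, hi⟩ := h
  rw [← hi]
  exact hM.eigenvalues_pos i

theorem mv_inv_mv {M : Matrix ι ι ℝ} (hM : M.PosDef) (v : Vec ι) : mv M⁻¹ (mv M v) = v := by
  have h := Matrix.nonsing_inv_mul M ((Matrix.isUnit_iff_isUnit_det M).1 hM.isUnit)
  have : mv (M⁻¹ * M) v = v := by simp [h, mv]
  simpa [mv] using this

theorem mv_mv_inv {M : Matrix ι ι ℝ} (hM : M.PosDef) (v : Vec ι) : mv M (mv M⁻¹ v) = v := by
  have h := Matrix.mul_nonsing_inv M ((Matrix.isUnit_iff_isUnit_det M).1 hM.isUnit)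
  have : mv (M * M⁻¹) v = v := by simp [h, mv]
  simpa [mv] using this

/-- The proximal term `‖· - a‖²_M / (2σ)`. -/
theorem gradConvex_wnorm {M : Matrix ι ι ℝ} (hM : M.PosDef) {σ : ℝ} (hσ : 0 < σ) (a : Vec ι) :
    GradConvex (lambdaMin M / σ) (fun x => 1 / (2 * σ) * wnorm M (x - a) ^ 2)
      (fun x => (1 / σ) • mv M (x - a)) := by
  have key : ∀ x z : Vec ι, 1 / (2 * σ) * wnorm M (z - a) ^ 2 - 1 / (2 * σ) * wnorm M (x - a) ^ 2
      - ⟪(1 / σ) • mv M (x - a), z - x⟫ = 1 / (2 * σ) * ⟪z - x, mv M (z - x)⟫ := by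
    intro x z
    rw [wnorm_sq hM.posSemidef, wnorm_sq hM.posSemidef]
    have e : z - a = (x - a) + (z - x) := by abel
    rw [e, real_inner_smul_left]
    generalize z - x = d
    generalize x - a = y
    have h1 : ⟪d, mv M y⟫ = ⟪mv M y, d⟫ := real_inner_comm _ _
    have h2 := inner_mv_comm hM.isHermitian y d
    have h3 : mv M (y + d) = mv M y + mv M d := map_add _ _ _
    rw [h3, inner_add_left, inner_add_right, inner_add_right, h1, ← h2]
    field_simp
    ring
  refine ⟨fun x => hasGradientAt_of_abs_le (C := 1 / (2 * σ) * specNorm M) fun z => ?_,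
    fun x z => ?_⟩
  · rw [key, abs_of_nonneg (mul_nonneg (by positivity) (inner_mv_nonneg hM.posSemidef _)),
      mul_assoc]
    refine mul_le_mul_of_nonneg_left ?_ (by positivity)
    calc ⟪z - x, mv M (z - x)⟫ ≤ ‖z - x‖ * ‖mv M (z - x)‖ := real_inner_le_norm _ _
      _ ≤ ‖z - x‖ * (specNorm M * ‖z - x‖) := by gcongr; exact norm_mv_le _ _
      _ = _ := by ring
  · have h1 := key x z
    have h2 := mul_le_mul_of_nonneg_left (lambdaMin_mul_norm_sq_le hM.isHermitian (z - x))
      (by positivity : 0 ≤ 1 / (2 * σ))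
    have h3 : lambdaMin M / σ / 2 * ‖z - x‖ ^ 2 = 1 / (2 * σ) * (lambdaMin M * ‖z - x‖ ^ 2) := by
      field_simp
    linarith

end Matrices

/-! ### The product space and the block-diagonal preconditioner. -/

section Blocks

variable {n m : ℕ}

@[simp]
theorem fstBlock_pair (x : Vec (Fin n)) (l : Vec (Fin m)) : fstBlock (pair x l) = x := rfl

@[simp]
theorem sndBlock_pair (x : Vec (Fin n)) (l : Vec (Fin m)) : sndBlock (pair x l) = l := rfl

theorem pair_fst_snd (z : Vec (Fin n ⊕ Fin m)) : pair (fstBlock z) (sndBlock z) = z := by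
  ext i
  cases i <;> rfl

theorem pair_sub (x x' : Vec (Fin n)) (l l' : Vec (Fin m)) :
    pair x l - pair x' l' = pair (x - x') (l - l') := by
  ext i
  cases i <;> rfl

theorem pair_smul (c : ℝ) (x : Vec (Fin n)) (l : Vec (Fin m)) :
    c • pair x l = pair (c • x) (c • l) := by
  ext i
  cases i <;> rfl

theorem inner_pair (x x' : Vec (Fin n)) (l l' : Vec (Fin m)) :
    ⟪pair x l, pair x' l'⟫ = ⟪x, x'⟫ + ⟪l, l'⟫ := by
  simp [pair, PiLp.inner_apply]

theorem pair_ne_zero {z : Vec (Fin n ⊕ Fin m)} (hz : z ≠ 0) : fstBlock z ≠ 0 ∨ sndBlock z ≠ 0 := by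
  by_contra! h
  apply hz
  rw [← pair_fst_snd z, h.1, h.2]
  ext i
  cases i <;> rfl

namespace Data

variable (D : Data n m)

theorem mv_M (x : Vec (Fin n)) (l : Vec (Fin m)) :
    mv D.M (pair x l) = pair (mv D.Mx x) (mv D.Ml l) := by
  simp only [mv, Data.M, pair, Matrix.toLpLin_toLp]
  ext i
  cases i <;> simp [Matrix.toLpLin_apply, Matrix.fromBlocks_mulVec, Function.comp_def]

theorem M_posDef (hMx : D.Mx.PosDef) (hMl : D.Ml.PosDef) : D.M.PosDef := by
  refine Matrix.PosDef.of_dotProduct_mulVec_pos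
    (Matrix.IsHermitian.fromBlocks hMx.isHermitian (by simp) hMl.isHermitian) fun z hz => ?_
  have e : star z ⬝ᵥ D.M.mulVec z = ⟪WithLp.toLp 2 z, mv D.M (WithLp.toLp 2 z)⟫ := by
    simp [mv, PiLp.inner_apply, dotProduct, mul_comm]
  rw [e]
  have hne : WithLp.toLp 2 z ≠ (0 : Vec (Fin n ⊕ Fin m)) := fun h => hz (by
    simpa using congrArg WithLp.ofLp h)
  generalize WithLp.toLp 2 z = w at hne
  have pos : ∀ {k : ℕ} {B : Matrix (Fin k) (Fin k) ℝ}, B.PosDef → ∀ v : Vec (Fin k), v ≠ 0 →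
      0 < ⟪v, mv B v⟫ := by
    intro k B hB v hv
    have := hB.dotProduct_mulVec_pos (x := v.ofLp) (by simpa using hv)
    simpa [mv, PiLp.inner_apply, dotProduct, mul_comm] using this
  rw [← pair_fst_snd w, mv_M, inner_pair]
  have hx := inner_mv_nonneg hMx.posSemidef (fstBlock w)
  have hl := inner_mv_nonneg hMl.posSemidef (sndBlock w)
  rcases pair_ne_zero hne with h | h
  · linarith [pos hMx _ h]
  · linarith [pos hMl _ h]

end Data

end Blocks

end ProxMultipliers

/-! ### The inner maximization, the decomposition of `F` and the proximal gradient step. -/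

namespace ProxMultipliers

namespace Data

variable {n m : ℕ}

/-- The standing assumptions on the data, with the properties of the conjugate `h*` in place of
those of `h`. -/
structure Regular (D : Data n m) : Prop where
  hn : 0 < n
  hm : 0 < m
  f₀ : GradConvex 0 D.f₀ (gradient D.f₀)
  lip : LipschitzWith D.L₀ (gradient D.f₀)
  g : ProperClosedConvex D.g
  k : ProperClosedConvex (conj D.h)
  Mx : D.Mx.PosDef
  Ml : D.Ml.PosDef
  σ : 0 < D.σ
  L : 0 < D.L

noncomputable section

variable (D : Data n m)

/-- The smooth part of the inner objective, with reversed sign. -/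
def dualQ (u l : Vec (Fin m)) : ℝ :=
  -- The `+ 0` matches the shape of `GradConvex.affine`.
  1 / (2 * D.σ) * wnorm D.Ml (l - D.lbar) ^ 2 + (⟪-u, l⟫ + 0)

/-- The minimizer of `h*(λ) + ‖λ - λ̄‖² / (2σ) - ⟨u, λ⟩`. -/
def dualArg (u : Vec (Fin m)) : Vec (Fin m) :=
  pick (argminSet fun l => conj D.h l + (D.dualQ u l : EReal))

/-- The proximal term in the primal variable. -/
def quad (x : Vec (Fin n)) : ℝ := 1 / (2 * D.σ) * wnorm D.Mx (x - D.xbar) ^ 2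

/-- The gradient of `f`. -/
def gradf (x : Vec (Fin n)) : Vec (Fin n) :=
  gradient D.f₀ x + mv D.A.transpose (D.dualArg (mv D.A x))

/-- The gradient of `f + quad`. -/
def gradF (x : Vec (Fin n)) : Vec (Fin n) := D.gradf x + (1 / D.σ) • mv D.Mx (x - D.xbar)

end

variable {D : Data n m}

namespace Regular

theorem lambdaMin_Mx_pos (hD : D.Regular) : 0 < lambdaMin D.Mx := by
  have := Fin.pos_iff_nonempty.1 hD.hn
  exact lambdaMin_pos hD.Mx

theorem lambdaMin_Ml_pos (hD : D.Regular) : 0 < lambdaMin D.Ml := by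
  have := Fin.pos_iff_nonempty.1 hD.hm
  exact lambdaMin_pos hD.Ml

theorem M_posDef (hD : D.Regular) : D.M.PosDef := D.M_posDef hD.Mx hD.Ml

theorem lambdaMin_M_pos (hD : D.Regular) : 0 < lambdaMin D.M := by
  have := Fin.pos_iff_nonempty.1 hD.hn
  exact lambdaMin_pos hD.M_posDef

/-- No assumption involves the base point, so it may be moved freely; this is what makes the
resolvent everywhere defined. -/
theorem rebase (hD : D.Regular) (x : Vec (Fin n)) (l : Vec (Fin m)) :
    Regular { D with xbar := x, lbar := l } :=
  ⟨hD.hn, hD.hm, hD.f₀, hD.lip, hD.g, hD.k, hD.Mx, hD.Ml, hD.σ, hD.L⟩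

theorem dualQ_gradConvex (hD : D.Regular) (u : Vec (Fin m)) :
    GradConvex (lambdaMin D.Ml / D.σ + 0) (D.dualQ u)
      (fun l => (1 / D.σ) • mv D.Ml (l - D.lbar) + -u) :=
  (gradConvex_wnorm hD.Ml hD.σ D.lbar).add (GradConvex.affine (-u) 0)

theorem argminSet_dualQ (hD : D.Regular) (u : Vec (Fin m)) :
    argminSet (fun l => conj D.h l + (D.dualQ u l : EReal)) = {D.dualArg u} := by
  obtain ⟨p, hp⟩ := hD.k.exists_argminSet_eq_singleton (hD.dualQ_gradConvex u)
    (by have := div_pos hD.lambdaMin_Ml_pos hD.σ; linarith)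
  rw [dualArg, pick_singleton hp, hp]

theorem dualArg_mem (hD : D.Regular) (u : Vec (Fin m)) :
    D.dualArg u ∈ argminSet fun l => conj D.h l + (D.dualQ u l : EReal) := by
  rw [hD.argminSet_dualQ]
  exact Set.mem_singleton _

theorem dualArg_subdiff (hD : D.Regular) (u : Vec (Fin m)) :
    u - (1 / D.σ) • mv D.Ml (D.dualArg u - D.lbar) ∈ subdiff (conj D.h) (D.dualArg u) := by
  have h := (hD.k.mem_argminSet_iff (hD.dualQ_gradConvex u)
    (by have := div_pos hD.lambdaMin_Ml_pos hD.σ; linarith)).1 (hD.dualArg_mem u)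
  have e : ∀ a : Vec (Fin m), -(a + -u) = u - a := fun a => by abel
  rwa [e] at h

theorem psiObj_eq (hD : D.Regular) (u l : Vec (Fin m)) :
    ((⟪u, l⟫ : ℝ) : EReal) - conj D.h l
      - ((1 / (2 * D.σ) * wnorm D.Ml (l - D.lbar) ^ 2 : ℝ) : EReal) =
    -(conj D.h l + (D.dualQ u l : EReal)) := by
  by_cases hl : conj D.h l = ⊤
  · simp [hl]
  obtain ⟨b, hb⟩ := hD.k.exists_coe hl
  rw [hb]
  norm_cast
  rw [dualQ, inner_neg_left]
  ring

theorem psi_eq (hD : D.Regular) (u : Vec (Fin m)) :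
    D.psi u = -(conj D.h (D.dualArg u) + (D.dualQ u (D.dualArg u) : EReal)) := by
  have h : D.psi u = ⨆ l, -(conj D.h l + (D.dualQ u l : EReal)) := by
    simp only [psi, hD.psiObj_eq]
  rw [h]
  exact iSup_eq_of_mem_argmaxSet (φ := fun l => -(conj D.h l + (D.dualQ u l : EReal)))
    fun z => EReal.neg_le_neg_iff.2 (hD.dualArg_mem u z)

theorem exists_conj_dualArg (hD : D.Regular) (u : Vec (Fin m)) :
    ∃ b : ℝ, conj D.h (D.dualArg u) = b :=
  hD.k.exists_coe (hD.k.ne_top_of_mem_subdiff (hD.dualArg_subdiff u))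

theorem psi_coe (hD : D.Regular) (u : Vec (Fin m)) : D.psi u = ((D.psi u).toReal : EReal) := by
  obtain ⟨b, hb⟩ := hD.exists_conj_dualArg u
  rw [hD.psi_eq, hb]
  norm_cast

/-- The maximizer for `u` is a competitor in the supremum defining `ψ(u')`. -/
theorem psi_le (hD : D.Regular) (u u' : Vec (Fin m)) :
    (D.psi u).toReal + ⟪D.dualArg u, u' - u⟫ ≤ (D.psi u').toReal := by
  obtain ⟨b, hb⟩ := hD.exists_conj_dualArg u
  have h1 : -(conj D.h (D.dualArg u) + (D.dualQ u' (D.dualArg u) : EReal)) ≤ D.psi u' := by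
    rw [← hD.psiObj_eq]
    exact le_iSup (fun l => ((⟪u', l⟫ : ℝ) : EReal) - conj D.h l
      - ((1 / (2 * D.σ) * wnorm D.Ml (l - D.lbar) ^ 2 : ℝ) : EReal)) _
  have h2 := hD.psi_eq u
  rw [hD.psi_coe, hb] at h1
  rw [hD.psi_coe, hb] at h2
  norm_cast at h1 h2
  rw [h2]
  simp only [dualQ, inner_neg_left] at *
  rw [inner_sub_right, real_inner_comm u', real_inner_comm u]
  linarith

/-- Monotonicity of `∂h*` at the two maximizers, against strong monotonicity of the proximal
gradient with modulus `λ_min(M^λ) / σ`, followed by Cauchy–Schwarz. -/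
theorem norm_dualArg_sub_le (hD : D.Regular) (u u' : Vec (Fin m)) :
    ‖D.dualArg u' - D.dualArg u‖ ≤ D.σ / lambdaMin D.Ml * ‖u' - u‖ := by
  have h1 := hD.k.subdiff_monotone (hD.dualArg_subdiff u) (hD.dualArg_subdiff u')
  have h2 := (gradConvex_wnorm hD.Ml hD.σ D.lbar).monotone (D.dualArg u) (D.dualArg u')
  set p := D.dualArg u
  set p' := D.dualArg u'
  have e : ∀ a b : Vec (Fin m), (u' - a) - (u - b) = (u' - u) - (a - b) := fun a b => by abel
  rw [e, inner_sub_left] at h1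
  have h3 : ⟪u' - u, p' - p⟫ ≤ ‖u' - u‖ * ‖p' - p‖ := real_inner_le_norm _ _
  have hl := hD.lambdaMin_Ml_pos
  have hσ := hD.σ
  have h4 : lambdaMin D.Ml / D.σ * ‖p' - p‖ ≤ ‖u' - u‖ := by
    rcases (norm_nonneg (p' - p)).eq_or_lt with h | h
    · rw [← h]
      simp
    · refine le_of_mul_le_mul_right ?_ h
      linarith
  rw [div_mul_eq_mul_div, div_le_iff₀ hσ] at h4
  rw [div_mul_eq_mul_div, le_div_iff₀ hl]
  linarith

theorem f_lipschitz (hD : D.Regular) (x z : Vec (Fin n)) :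
    ‖D.gradf z - D.gradf x‖ ≤ D.L * ‖z - x‖ := by
  have h1 : ‖gradient D.f₀ z - gradient D.f₀ x‖ ≤ D.L₀ * ‖z - x‖ := hD.lip.norm_sub_le z x
  have hc : 0 ≤ D.σ / lambdaMin D.Ml := (div_pos hD.σ hD.lambdaMin_Ml_pos).le
  have hs := specNorm_nonneg D.A
  have h2 : ‖mv D.A.transpose (D.dualArg (mv D.A z)) - mv D.A.transpose (D.dualArg (mv D.A x))‖
      ≤ D.σ / lambdaMin D.Ml * specNorm D.A ^ 2 * ‖z - x‖ := by
    rw [← map_sub]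
    calc _ ≤ specNorm D.A * ‖D.dualArg (mv D.A z) - D.dualArg (mv D.A x)‖ :=
          norm_mv_transpose_le _ _
      _ ≤ specNorm D.A * (D.σ / lambdaMin D.Ml * ‖mv D.A z - mv D.A x‖) := by
          gcongr
          exact hD.norm_dualArg_sub_le _ _
      _ ≤ specNorm D.A * (D.σ / lambdaMin D.Ml * (specNorm D.A * ‖z - x‖)) := by
          gcongr
          rw [← map_sub]
          exact norm_mv_le _ _
      _ = _ := by ring
  calc ‖D.gradf z - D.gradf x‖ = ‖(gradient D.f₀ z - gradient D.f₀ x) +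
        (mv D.A.transpose (D.dualArg (mv D.A z)) - mv D.A.transpose (D.dualArg (mv D.A x)))‖ := by
        rw [gradf, gradf, add_sub_add_comm]
    _ ≤ _ := (norm_add_le _ _).trans (add_le_add h1 h2)
    _ = D.L * ‖z - x‖ := by rw [Data.L]; ring

theorem f_gradConvex (hD : D.Regular) : GradConvex 0 D.f D.gradf := by
  refine GradConvex.of_lipschitz (fun x z => ?_) hD.f_lipschitz
  have h1 := hD.f₀.le x z
  have h2 := hD.psi_le (mv D.A x) (mv D.A z)
  rw [← map_sub, real_inner_comm, inner_mv_transpose, real_inner_comm] at h2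
  simp only [f, gradf, inner_add_left]
  linarith

theorem gradient_f (hD : D.Regular) (x : Vec (Fin n)) : gradient D.f x = D.gradf x :=
  (hD.f_gradConvex.grad x).gradient

theorem smooth_gradConvex (hD : D.Regular) :
    GradConvex (0 + lambdaMin D.Mx / D.σ) (fun x => D.f x + D.quad x) D.gradF :=
  hD.f_gradConvex.add (gradConvex_wnorm hD.Mx hD.σ D.xbar)

theorem modulus_pos (hD : D.Regular) : 0 < 0 + lambdaMin D.Mx / D.σ := by
  have := div_pos hD.lambdaMin_Mx_pos hD.σ
  linarith

theorem dualObj_eq (hD : D.Regular) {x : Vec (Fin n)} {a : ℝ} (ha : D.g x = a)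
    (l : Vec (Fin m)) :
    D.dualObj x l =
      ((D.f₀ x + a : ℝ) : EReal) - (conj D.h l + (D.dualQ (mv D.A x) l : EReal)) := by
  rw [dualObj, lagr, ha]
  by_cases hl : conj D.h l = ⊤
  · simp [hl]
  obtain ⟨b, hb⟩ := hD.k.exists_coe hl
  rw [hb]
  norm_cast
  rw [dualQ, inner_neg_left]
  ring

theorem argmaxSet_dualObj (hD : D.Regular) {x : Vec (Fin n)} (hx : D.g x ≠ ⊤) :
    argmaxSet (D.dualObj x) = {D.dualArg (mv D.A x)} := by
  rw [← hD.argminSet_dualQ]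
  obtain ⟨a, ha⟩ := hD.g.exists_coe hx
  have key : ∀ s t : EReal, ((D.f₀ x + a : ℝ) : EReal) - s ≤ ((D.f₀ x + a : ℝ) : EReal) - t ↔
      t ≤ s := by
    intro s t
    induction s <;> induction t <;> simp
    · exact EReal.coe_ne_top (D.f₀ x + a - _)
    · norm_cast
      constructor <;> intro h <;> linarith
    · exact EReal.coe_ne_bot _
  ext l
  simp only [argmaxSet, argminSet, Set.mem_ofPred_eq, hD.dualObj_eq ha, key]

theorem Lam_eq (hD : D.Regular) {x : Vec (Fin n)} (hx : D.g x ≠ ⊤) :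
    D.Lam x = D.dualArg (mv D.A x) :=
  pick_singleton (hD.argmaxSet_dualObj hx)

theorem F_eq (hD : D.Regular) (x : Vec (Fin n)) :
    D.F x = D.g x + ((D.f x + D.quad x : ℝ) : EReal) := by
  by_cases hx : D.g x = ⊤
  -- A multiplier in the domain of `h*` is needed: where `h*` is `⊤` the Lagrangian is `⊥`, even if
  -- `g x = ⊤`.
  · obtain ⟨l, b, hb⟩ := hD.k.exists_real
    have h : (⊤ : EReal) ≤ ⨆ l, D.dualObj x l := by
      have : D.dualObj x l = ⊤ := by
        simp [dualObj, lagr, hx, hb, -one_div, -EReal.coe_mul]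
      rw [← this]
      exact le_iSup (D.dualObj x) l
    rw [F, top_le_iff.1 h, hx, EReal.top_add_coe, EReal.top_add_coe]
  · obtain ⟨a, ha⟩ := hD.g.exists_coe hx
    have hm : D.dualArg (mv D.A x) ∈ argmaxSet (D.dualObj x) := by
      rw [hD.argmaxSet_dualObj hx]
      exact Set.mem_singleton _
    rw [F, iSup_eq_of_mem_argmaxSet hm, hD.dualObj_eq ha, ha, sub_eq_add_neg, ← hD.psi_eq,
      hD.psi_coe, f, quad]
    norm_cast
    ring

theorem decomp (hD : D.Regular) (x : Vec (Fin n)) : D.F x = (D.f x : EReal) + D.phi x := by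
  rw [hD.F_eq, phi, EReal.coe_add, add_left_comm]
  rfl

theorem proxGradObj_eq (hD : D.Regular) (x y : Vec (Fin n)) :
    D.proxGradObj x y = D.g y +
      ((D.L / 2 * ‖y - (x - (1 / D.L) • D.gradf x)‖ ^ 2 + D.quad y : ℝ) : EReal) := by
  rw [proxGradObj, phi, hD.gradient_f, EReal.coe_add, add_left_comm]
  rfl

theorem prox_gradConvex (hD : D.Regular) (x : Vec (Fin n)) :
    GradConvex (D.L + lambdaMin D.Mx / D.σ)
      (fun y => D.L / 2 * ‖y - (x - (1 / D.L) • D.gradf x)‖ ^ 2 + D.quad y)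
      (fun y => D.L • (y - (x - (1 / D.L) • D.gradf x)) + (1 / D.σ) • mv D.Mx (y - D.xbar)) :=
  (gradConvex_norm_sq D.L _).add (gradConvex_wnorm hD.Mx hD.σ D.xbar)

theorem argminSet_proxGradObj (hD : D.Regular) (x : Vec (Fin n)) :
    argminSet (D.proxGradObj x) = {D.G x} := by
  have hpos : 0 < D.L + lambdaMin D.Mx / D.σ :=
    add_pos hD.L (div_pos hD.lambdaMin_Mx_pos hD.σ)
  obtain ⟨p, hp⟩ := hD.g.exists_argminSet_eq_singleton (hD.prox_gradConvex x) hpos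
  have e : D.proxGradObj x = fun y => D.g y +
      ((D.L / 2 * ‖y - (x - (1 / D.L) • D.gradf x)‖ ^ 2 + D.quad y : ℝ) : EReal) :=
    funext (hD.proxGradObj_eq x)
  rw [← e] at hp
  rw [G, pick_singleton hp, hp]

theorem G_subdiff (hD : D.Regular) (x : Vec (Fin n)) :
    -(D.L • (D.G x - (x - (1 / D.L) • D.gradf x)) + (1 / D.σ) • mv D.Mx (D.G x - D.xbar)) ∈
      subdiff D.g (D.G x) := by
  have hpos : 0 < D.L + lambdaMin D.Mx / D.σ :=
    add_pos hD.L (div_pos hD.lambdaMin_Mx_pos hD.σ)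
  have h : D.G x ∈ argminSet (D.proxGradObj x) := by
    rw [hD.argminSet_proxGradObj]
    exact Set.mem_singleton _
  rw [funext (hD.proxGradObj_eq x)] at h
  exact (hD.g.mem_argminSet_iff (hD.prox_gradConvex x) hpos.le).1 h

theorem mem_subdiff_F (hD : D.Regular) {s x : Vec (Fin n)} :
    s ∈ subdiff D.F x ↔ s - D.gradF x ∈ subdiff D.g x := by
  rw [funext hD.F_eq]
  exact hD.g.mem_subdiff_add hD.smooth_gradConvex hD.modulus_pos.le

theorem exists_argminSet_F (hD : D.Regular) : ∃ p, argminSet D.F = {p} := by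
  rw [funext hD.F_eq]
  exact hD.g.exists_argminSet_eq_singleton hD.smooth_gradConvex hD.modulus_pos

theorem F_coe (hD : D.Regular) {x : Vec (Fin n)} (hx : D.g x ≠ ⊤) : ∃ a : ℝ, D.F x = a := by
  obtain ⟨a, ha⟩ := hD.g.exists_coe hx
  exact ⟨a + (D.f x + D.quad x), by rw [hD.F_eq, ha]; norm_cast⟩

/-- The optimality condition of the step involves `∇f(y)`; replacing it by the gradient at the new
point costs the difference of the two gradients. -/
theorem subgradient_G (hD : D.Regular) (y : Vec (Fin n)) :
    D.L • (y - D.G y) - (D.gradf y - D.gradf (D.G y)) ∈ subdiff D.F (D.G y) := by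
  rw [hD.mem_subdiff_F]
  have e : D.L • (D.G y - (y - (1 / D.L) • D.gradf y)) = D.L • (D.G y - y) + D.gradf y := by
    rw [sub_sub_eq_add_sub, add_sub_right_comm, smul_add, smul_smul,
      mul_one_div_cancel hD.L.ne', one_smul]
  convert hD.G_subdiff y using 1
  rw [e, gradF]
  module

/-- The fundamental inequality of the proximal gradient step. -/
theorem F_G_le (hD : D.Regular) (x z : Vec (Fin n)) {a b : ℝ} (ha : D.F (D.G x) = a)
    (hb : D.F z = b) :
    a + D.L / 2 * ‖z - D.G x‖ ^ 2 ≤ b + D.L / 2 * ‖z - x‖ ^ 2 := by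
  obtain ⟨a', ha'⟩ := hD.g.exists_coe (hD.g.ne_top_of_mem_subdiff (hD.G_subdiff x))
  have hz : D.g z ≠ ⊤ := fun h => by
    rw [hD.F_eq, h, EReal.top_add_coe] at hb
    exact EReal.coe_ne_top b hb.symm
  obtain ⟨b', hb'⟩ := hD.g.exists_coe hz
  rw [hD.F_eq, ha'] at ha
  rw [hD.F_eq, hb'] at hb
  norm_cast at ha hb
  have h1 := (hD.prox_gradConvex x).growth (hD.G_subdiff x) ha' hb'
  have h2 := le_of_lipschitz_gradient hD.f_gradConvex.grad hD.f_lipschitz x (D.G x)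
  have h3 := hD.f_gradConvex.le x z
  -- Up to a constant that cancels, the squared distance is the linearization of `f` at `x` plus
  -- `(L/2) ‖y - x‖²`. The linear part is then compared with `f` by the descent lemma at `𝒢_F(x)`
  -- and by convexity at `z`.
  have h4 : ∀ y : Vec (Fin n), D.L / 2 * ‖y - (x - (1 / D.L) • D.gradf x)‖ ^ 2 =
      D.L / 2 * ‖y - x‖ ^ 2 + ⟪D.gradf x, y - x⟫
        + D.L / 2 * ‖(1 / D.L) • D.gradf x‖ ^ 2 := by
    intro y
    have hL := hD.L.ne'
    rw [sub_sub_eq_add_sub, add_sub_right_comm, norm_add_sq_real, real_inner_smul_right,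
      real_inner_comm]
    field_simp
  simp only [h4] at h1
  have h5 : 0 ≤ lambdaMin D.Mx / D.σ / 2 * ‖z - D.G x‖ ^ 2 :=
    mul_nonneg (div_pos (div_pos hD.lambdaMin_Mx_pos hD.σ) two_pos).le (sq_nonneg _)
  linarith

end Regular

end Data

end ProxMultipliers

/-! ### The operator `T_ℓ`, its resolvent and the two implications. -/

namespace ProxMultipliers

namespace Data

namespace Regular

variable {n m : ℕ} {D : Data n m}

theorem lagr_coe {x : Vec (Fin n)} {l : Vec (Fin m)} {a b : ℝ} (ha : D.g x = a)
    (hb : conj D.h l = b) : D.lagr x l = ((D.f₀ x + a + ⟪mv D.A x, l⟫ - b : ℝ) : EReal) := by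
  rw [lagr, ha, hb]
  norm_cast

theorem lagr_eq_top {x : Vec (Fin n)} {l : Vec (Fin m)} {b : ℝ} (ha : D.g x = ⊤)
    (hb : conj D.h l = b) : D.lagr x l = ⊤ := by
  simp [lagr, ha, hb]

theorem lagr_eq_bot {x : Vec (Fin n)} {l : Vec (Fin m)} (hb : conj D.h l = ⊤) :
    D.lagr x l = ⊥ := by
  simp [lagr, hb]

theorem ne_top_of_mem_T (hD : D.Regular) {x : Vec (Fin n)} {l : Vec (Fin m)}
    {t : Vec (Fin n ⊕ Fin m)} (ht : t ∈ D.T (pair x l)) : D.g x ≠ ⊤ ∧ conj D.h l ≠ ⊤ := by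
  obtain ⟨h1, h2⟩ := ht
  simp only [fstBlock_pair, sndBlock_pair] at h1 h2
  obtain ⟨x₀, a₀, ha₀⟩ := hD.g.exists_real
  obtain ⟨l₀, b₀, hb₀⟩ := hD.k.exists_real
  have hl : conj D.h l ≠ ⊤ := by
    intro hl
    have h := h2 l₀
    rw [lagr_eq_bot hl, EReal.bot_add, le_bot_iff] at h
    by_cases hx : D.g x = ⊤
    · rw [lagr_eq_top hx hb₀] at h
      exact top_ne_bot h
    · obtain ⟨a, ha⟩ := hD.g.exists_coe hx
      rw [lagr_coe ha hb₀] at h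
      exact EReal.coe_ne_bot _ h
  refine ⟨fun hx => ?_, hl⟩
  obtain ⟨b, hb⟩ := hD.k.exists_coe hl
  have h := h1 x₀
  rw [lagr_eq_top hx hb, lagr_coe ha₀ hb, EReal.top_add_coe, top_le_iff] at h
  exact EReal.coe_ne_top _ h

/-- In the sum of the four saddle inequalities, taken at the two points and the two mixed points,
all values of `ℓ` cancel; they are finite by `ne_top_of_mem_T`. -/
theorem T_monotone (hD : D.Regular) {w w' t t' : Vec (Fin n ⊕ Fin m)} (ht : t ∈ D.T w)
    (ht' : t' ∈ D.T w') : 0 ≤ ⟪t' - t, w' - w⟫ := by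
  rw [← pair_fst_snd w] at ht ⊢
  rw [← pair_fst_snd w'] at ht' ⊢
  rw [← pair_fst_snd t, ← pair_fst_snd t']
  obtain ⟨hx, hl⟩ := hD.ne_top_of_mem_T ht
  obtain ⟨hx', hl'⟩ := hD.ne_top_of_mem_T ht'
  obtain ⟨a, ha⟩ := hD.g.exists_coe hx
  obtain ⟨a', ha'⟩ := hD.g.exists_coe hx'
  obtain ⟨b, hb⟩ := hD.k.exists_coe hl
  obtain ⟨b', hb'⟩ := hD.k.exists_coe hl'
  obtain ⟨h1, h2⟩ := ht
  obtain ⟨h1', h2'⟩ := ht'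
  simp only [fstBlock_pair, sndBlock_pair] at h1 h2 h1' h2'
  have i1 := h1 (fstBlock w')
  have i2 := h2 (sndBlock w')
  have i3 := h1' (fstBlock w)
  have i4 := h2' (sndBlock w)
  simp only [lagr_coe ha hb, lagr_coe ha' hb, lagr_coe ha hb', lagr_coe ha' hb'] at i1 i2 i3 i4
  norm_cast at i1 i2 i3 i4
  simp only [pair_sub, inner_pair, inner_sub_left, inner_sub_right, inner_neg_left] at *
  linarith

theorem mem_T (hD : D.Regular) {x v : Vec (Fin n)} {l u : Vec (Fin m)}
    (hv : v - gradient D.f₀ x - mv D.A.transpose l ∈ subdiff D.g x)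
    (hu : u + mv D.A x ∈ subdiff (conj D.h) l) :
    pair v u ∈ D.T (pair x l) := by
  obtain ⟨a, ha⟩ := hD.g.exists_coe (hD.g.ne_top_of_mem_subdiff hv)
  obtain ⟨b, hb⟩ := hD.k.exists_coe (hD.k.ne_top_of_mem_subdiff hu)
  refine ⟨fun x' => ?_, fun l' => ?_⟩
  · simp only [fstBlock_pair, sndBlock_pair]
    by_cases hx' : D.g x' = ⊤
    · rw [lagr_eq_top hx' hb]
      exact le_top
    obtain ⟨a', ha'⟩ := hD.g.exists_coe hx'
    have h1 := le_of_mem_subdiff hv ha ha'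
    have h2 := hD.f₀.le x x'
    rw [lagr_coe ha hb, lagr_coe ha' hb]
    norm_cast
    rw [inner_sub_left, inner_sub_left, real_inner_comm _ (mv D.A.transpose l),
      ← inner_mv_transpose, mv, map_sub, inner_sub_left] at h1
    simp only [mv] at *
    linarith
  · simp only [fstBlock_pair, sndBlock_pair]
    by_cases hl' : conj D.h l' = ⊤
    · rw [lagr_eq_bot hl']
      exact bot_le
    obtain ⟨b', hb'⟩ := hD.k.exists_coe hl'
    have h1 := le_of_mem_subdiff hu hb hb'
    rw [lagr_coe ha hb, lagr_coe ha hb']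
    norm_cast
    rw [inner_add_left, inner_sub_right (mv D.A x)] at h1
    rw [inner_neg_left]
    linarith

/-- A subgradient `s` of `F` at `x` gives an element of `T_ℓ` at `(x, Λ(x))`. -/
theorem mem_T_of_mem_subdiff_F (hD : D.Regular) {x s : Vec (Fin n)} (hs : s ∈ subdiff D.F x) :
    pair s 0 - (1 / D.σ) • mv D.M (pair x (D.Lam x) - D.zbar) ∈ D.T (pair x (D.Lam x)) := by
  rw [hD.mem_subdiff_F] at hs
  rw [hD.Lam_eq (hD.g.ne_top_of_mem_subdiff hs), zbar, pair_sub, mv_M, pair_smul, pair_sub]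
  set l := D.dualArg (mv D.A x) with hl
  refine hD.mem_T ?_ ?_
  · convert hs using 1
    rw [gradF, gradf]
    abel
  · convert hD.dualArg_subdiff (mv D.A x) using 1
    rw [← hl]
    abel

/-- Stability of the resolvent inclusion under errors in the primal block only. Equal errors give
uniqueness of the resolvent; a zero error on one side gives the error bound. -/
theorem norm_sq_le_of_inner (hD : D.Regular) {w w' : Vec (Fin n ⊕ Fin m)} {s s' : Vec (Fin n)}
    {z : Vec (Fin n ⊕ Fin m)}
    (h : pair s 0 - (1 / D.σ) • mv D.M (w - z) ∈ D.T w)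
    (h' : pair s' 0 - (1 / D.σ) • mv D.M (w' - z) ∈ D.T w') :
    wnorm D.M (w' - w) ^ 2 ≤ D.σ * ⟪s' - s, fstBlock w' - fstBlock w⟫ := by
  have h1 := hD.T_monotone h h'
  have e : (pair s' 0 - (1 / D.σ) • mv D.M (w' - z)) - (pair s 0 - (1 / D.σ) • mv D.M (w - z)) =
      pair (s' - s) (0 : Vec (Fin m)) - (1 / D.σ) • mv D.M (w' - w) := by
    have : w' - w = (w' - z) - (w - z) := by abel
    have h2 : mv D.M (w' - w) = mv D.M (w' - z) - mv D.M (w - z) := by rw [this, mv, map_sub]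
    have h3 : pair (s' - s) (0 : Vec (Fin m)) = pair s' 0 - pair s 0 := by
      rw [pair_sub, sub_zero]
    rw [h2, h3]
    module
  have e2 : ⟪pair (s' - s) (0 : Vec (Fin m)), w' - w⟫ =
      ⟪s' - s, fstBlock w' - fstBlock w⟫ := by
    conv_lhs => rw [← pair_fst_snd w, ← pair_fst_snd w', pair_sub, inner_pair, inner_zero_left]
    simp
  rw [e, inner_sub_left, real_inner_smul_left, e2, real_inner_comm _ (mv D.M (w' - w)),
    ← wnorm_sq hD.M_posDef.posSemidef] at h1
  have hσ := hD.σ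
  rw [one_div, inv_mul_eq_div, sub_nonneg, div_le_iff₀ hσ] at h1
  linarith

theorem eq_of_wnorm_sq_nonpos (hD : D.Regular) {v : Vec (Fin n ⊕ Fin m)}
    (h : wnorm D.M v ^ 2 ≤ 0) : v = 0 := by
  have h1 := lambdaMin_mul_norm_sq_le hD.M_posDef.isHermitian v
  rw [← wnorm_sq hD.M_posDef.posSemidef] at h1
  have h2 : ‖v‖ ^ 2 ≤ 0 := by
    have := hD.lambdaMin_M_pos
    by_contra! h3
    have := mul_pos this h3
    linarith
  have h3 : ‖v‖ = 0 := pow_eq_zero_iff two_ne_zero |>.1 (le_antisymm h2 (sq_nonneg _))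
  simpa using h3

theorem mem_resolventSet_iff (hD : D.Regular) {z w : Vec (Fin n ⊕ Fin m)} :
    w ∈ resolventSet D.T D.M D.σ z ↔
      pair 0 0 - (1 / D.σ) • mv D.M (w - z) ∈ D.T w := by
  have h0 : (pair 0 0 : Vec (Fin n ⊕ Fin m)) = 0 := by
    ext i
    cases i <;> rfl
  have hσ := hD.σ.ne'
  rw [h0, zero_sub]
  constructor
  · rintro ⟨t, ht, rfl⟩
    rw [sub_add_cancel_left]
    convert ht using 1
    rw [mv, map_neg, map_smul]
    change -((1 / D.σ) • -(D.σ • mv D.M (mv D.M⁻¹ t))) = t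
    rw [mv_mv_inv hD.M_posDef, smul_neg, neg_neg, smul_smul, one_div_mul_cancel hσ, one_smul]
  · intro h
    refine ⟨_, h, ?_⟩
    rw [mv, map_neg, map_smul]
    change w + D.σ • -((1 / D.σ) • mv D.M⁻¹ (mv D.M (w - z))) = z
    rw [mv_inv_mv hD.M_posDef, smul_neg, smul_smul, mul_one_div_cancel hσ, one_smul]
    abel

theorem resolventSet_subsingleton (hD : D.Regular) (z : Vec (Fin n ⊕ Fin m)) :
    (resolventSet D.T D.M D.σ z).Subsingleton := by
  intro w hw w' hw'
  rw [hD.mem_resolventSet_iff] at hw hw'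
  have h := hD.norm_sq_le_of_inner hw hw'
  rw [sub_self, inner_zero_left, mul_zero] at h
  exact (sub_eq_zero.1 (hD.eq_of_wnorm_sq_nonpos h)).symm

theorem mem_resolventSet_of_argmin (hD : D.Regular) {x : Vec (Fin n)} (hx : x ∈ argminSet D.F) :
    pair x (D.Lam x) ∈ resolventSet D.T D.M D.σ D.zbar := by
  rw [hD.mem_resolventSet_iff]
  exact hD.mem_T_of_mem_subdiff_F (fun z => by simpa using hx z)

/-- Take the minimizer of the `F` built with base point `z`; `T_ℓ`, `M` and `σ` do not depend on the
base point. -/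
theorem resolventSet_nonempty (hD : D.Regular) (z : Vec (Fin n ⊕ Fin m)) :
    (resolventSet D.T D.M D.σ z).Nonempty := by
  have hD' := hD.rebase (fstBlock z) (sndBlock z)
  obtain ⟨p, hp⟩ := hD'.exists_argminSet_F
  have h := hD'.mem_resolventSet_of_argmin (x := p) (by rw [hp]; exact Set.mem_singleton p)
  rw [zbar, pair_fst_snd] at h
  exact ⟨_, h⟩

theorem resolventSet_eq (hD : D.Regular) (z : Vec (Fin n ⊕ Fin m)) :
    resolventSet D.T D.M D.σ z = {resolventPt D.T D.M D.σ z} :=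
  (hD.resolventSet_subsingleton z).eq_singleton_of_mem (pick_mem (hD.resolventSet_nonempty z))

theorem resolventPt_zbar (hD : D.Regular) {x : Vec (Fin n)} (hx : x ∈ argminSet D.F) :
    resolventPt D.T D.M D.σ D.zbar = pair x (D.Lam x) := by
  have h := hD.mem_resolventSet_of_argmin hx
  rw [hD.resolventSet_eq] at h
  exact h.symm

theorem sqrt_lambdaMin_Mx_mul_norm_le (hD : D.Regular) (v : Vec (Fin n ⊕ Fin m)) :
    √(lambdaMin D.Mx) * ‖fstBlock v‖ ≤ wnorm D.M v := by
  refine abs_le_of_sq_le_sq' ?_ (wnorm_nonneg _ _) |>.2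
  rw [wnorm_sq hD.M_posDef.posSemidef, mul_pow, Real.sq_sqrt hD.lambdaMin_Mx_pos.le]
  conv_rhs => rw [← pair_fst_snd v, mv_M, inner_pair]
  have h1 := lambdaMin_mul_norm_sq_le hD.Mx.isHermitian (fstBlock v)
  have h2 := inner_mv_nonneg hD.Ml.posSemidef (sndBlock v)
  linarith

theorem lambdaMin_M_mul_norm_sq_le (hD : D.Regular) (v : Vec (Fin n ⊕ Fin m)) :
    lambdaMin D.M * ‖fstBlock v‖ ^ 2 ≤ wnorm D.M v ^ 2 := by
  have h1 := lambdaMin_mul_norm_sq_le hD.M_posDef.isHermitian v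
  rw [← wnorm_sq hD.M_posDef.posSemidef] at h1
  refine le_trans (mul_le_mul_of_nonneg_left ?_ hD.lambdaMin_M_pos.le) h1
  conv_rhs => rw [← pair_fst_snd v, ← real_inner_self_eq_norm_sq, inner_pair,
    real_inner_self_eq_norm_sq, real_inner_self_eq_norm_sq]
  linarith [sq_nonneg ‖sndBlock v‖]

/-- The distance to the exact proximal point is controlled by any subgradient of `F`. -/
theorem wnorm_sub_resolventPt_le (hD : D.Regular) {x s : Vec (Fin n)} (hs : s ∈ subdiff D.F x) :
    wnorm D.M (pair x (D.Lam x) - resolventPt D.T D.M D.σ D.zbar) ≤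
      ‖s‖ / (√(lambdaMin D.Mx) / D.σ) := by
  have hJ : resolventPt D.T D.M D.σ D.zbar ∈ resolventSet D.T D.M D.σ D.zbar :=
    pick_mem (hD.resolventSet_nonempty _)
  rw [hD.mem_resolventSet_iff] at hJ
  have h1 := hD.norm_sq_le_of_inner hJ (hD.mem_T_of_mem_subdiff_F hs)
  set w := pair x (D.Lam x)
  set w' := resolventPt D.T D.M D.σ D.zbar
  have h2 := hD.sqrt_lambdaMin_Mx_mul_norm_le (w - w')
  have e : fstBlock (w - w') = fstBlock w - fstBlock w' := rfl
  rw [sub_zero, ← e] at h1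
  have h3 : ⟪s, fstBlock (w - w')⟫ ≤ ‖s‖ * ‖fstBlock (w - w')‖ := real_inner_le_norm _ _
  have hσ := hD.σ
  have hl := Real.sqrt_pos.2 hD.lambdaMin_Mx_pos
  rw [le_div_iff₀ (div_pos hl hσ), mul_div_assoc', div_le_iff₀ hσ]
  rcases (wnorm_nonneg D.M (w - w')).eq_or_lt with h | h
  · rw [← h, zero_mul]
    positivity
  · refine le_of_mul_le_mul_right ?_ h
    calc wnorm D.M (w - w') * √(lambdaMin D.Mx) * wnorm D.M (w - w')
        = √(lambdaMin D.Mx) * wnorm D.M (w - w') ^ 2 := by ring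
      _ ≤ √(lambdaMin D.Mx) * (D.σ * (‖s‖ * ‖fstBlock (w - w')‖)) := by
          gcongr
          exact h1.trans (by gcongr)
      _ = D.σ * ‖s‖ * (√(lambdaMin D.Mx) * ‖fstBlock (w - w')‖) := by ring
      _ ≤ D.σ * ‖s‖ * wnorm D.M (w - w') := by gcongr
      _ = _ := by ring

theorem fstar_eq (hD : D.Regular) {x : Vec (Fin n)} (hx : x ∈ argminSet D.F) :
    ∃ a : ℝ, D.F x = a ∧ D.Fstar = a := by
  have h : D.g x ≠ ⊤ := hD.g.ne_top_of_mem_subdiff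
    (hD.mem_subdiff_F.1 (fun z => by simpa using hx z : (0 : Vec (Fin n)) ∈ subdiff D.F x))
  obtain ⟨a, ha⟩ := hD.F_coe h
  exact ⟨a, ha, by rw [Fstar, iInf_eq_of_mem_argminSet hx, ha]⟩

theorem wellPosed (hD : D.Regular) : D.WellPosed where
  lam x hx := by rw [hD.Lam_eq hx, hD.argmaxSet_dualObj hx]
  psi_finite u := by
    rw [hD.psi_coe]
    exact ⟨EReal.coe_ne_bot _, EReal.coe_ne_top _⟩
  f_diff x := (hD.f_gradConvex.grad x).differentiableAt
  decomp := hD.decomp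
  minimizer := hD.exists_argminSet_F
  fstar_finite := by
    obtain ⟨p, hp⟩ := hD.exists_argminSet_F
    obtain ⟨a, -, ha⟩ := hD.fstar_eq (x := p) (by rw [hp]; exact Set.mem_singleton p)
    rw [ha]
    exact ⟨EReal.coe_ne_bot _, EReal.coe_ne_top _⟩
  proxGrad := hD.argminSet_proxGradObj
  resolvent := hD.resolventSet_eq

theorem igppaCond_of_stopCrit (hD : D.Regular) {η δ : ℝ} (hη : 0 < η) (hδ : 0 < δ)
    {x : Vec (Fin n)} (h : D.StopCrit η δ x) :
    IGPPACond D.T D.M D.σ η δ D.zbar (pair x (D.Lam x)) := by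
  rw [IGPPACond]
  have hl := div_pos (Real.sqrt_pos.2 hD.lambdaMin_Mx_pos) hD.σ
  set ε := min η (δ * wnorm D.M (pair x (D.Lam x) - D.zbar))
  have hε : 0 ≤ ε := le_min hη.le (mul_nonneg hδ.le (wnorm_nonneg _ _))
  -- Relaxing the bound to any `r > ε` supplies an actual subgradient, so attainment of the distance
  -- is not needed.
  refine le_of_forall_gt_imp_ge_of_dense fun r hr => ?_
  have hr0 : 0 < r := hε.trans_lt hr
  have h1 : Metric.infEDist 0 (subdiff D.F x) < ENNReal.ofReal (√(lambdaMin D.Mx) / D.σ * r) :=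
    h.trans_lt ((ENNReal.ofReal_lt_ofReal_iff (mul_pos hl hr0)).2
      (mul_lt_mul_of_pos_left hr hl))
  obtain ⟨s, hs, hs'⟩ := Metric.infEDist_lt_iff.1 h1
  rw [edist_dist, ENNReal.ofReal_lt_ofReal_iff (mul_pos hl hr0), dist_zero_left] at hs'
  refine (hD.wnorm_sub_resolventPt_le hs).trans ?_
  rw [div_le_iff₀ hl]
  linarith

/-- The subgradient of `F` produced by the proximal gradient step. -/
theorem norm_subgradient_G_sq_le (hD : D.Regular) (y : Vec (Fin n)) :
    ‖D.L • (y - D.G y) - (D.gradf y - D.gradf (D.G y))‖ ^ 2 ≤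
      2 * D.L ^ 2 * ‖y - D.G y‖ ^ 2 := by
  have h1 := hD.f_lipschitz (D.G y) y
  have h2 := hD.f_gradConvex.monotone (D.G y) y
  have hL := hD.L
  rw [norm_sub_sq_real, norm_smul, Real.norm_of_nonneg hL.le, real_inner_smul_left,
    real_inner_comm]
  have h3 : ‖D.gradf y - D.gradf (D.G y)‖ ^ 2 ≤ (D.L * ‖y - D.G y‖) ^ 2 := by gcongr
  -- Monotonicity of the gradient makes the cross term nonpositive, whence the factor `2` rather
  -- than `4`.
  nlinarith

theorem stopCrit_of_mem_subdiff (hD : D.Regular) {η δ : ℝ} {x s : Vec (Fin n)}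
    (hs : s ∈ subdiff D.F x)
    (h1 : ‖s‖ / (√(lambdaMin D.Mx) / D.σ) ≤ η)
    (h2 : ‖s‖ / (√(lambdaMin D.Mx) / D.σ) ≤ δ * wnorm D.M (pair x (D.Lam x) - D.zbar)) :
    D.StopCrit η δ x := by
  have hl := div_pos (Real.sqrt_pos.2 hD.lambdaMin_Mx_pos) hD.σ
  refine (Metric.infEDist_le_edist_of_mem hs).trans ?_
  rw [edist_dist, dist_zero_left]
  refine ENNReal.ofReal_le_ofReal ?_
  have := (div_le_iff₀ hl).1 (le_min h1 h2)
  linarith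

theorem stopCrit_of_gap_le (hD : D.Regular) {η δ : ℝ} (hη : 0 < η) (hδ : 0 < δ)
    {y : Vec (Fin n)}
    (h : D.F y - D.Fstar ≤
        ((lambdaMin D.Mx / D.σ ^ 2 : ℝ) : EReal) *
          min ((η ^ 2 / (4 * D.L) : ℝ) : EReal)
            (((δ ^ 2 * lambdaMin D.M / (2 * (1 + δ) ^ 2 * D.L ^ 2) : ℝ) : EReal) *
              (D.F (D.G D.xbar) - D.Fstar))) :
    D.StopCrit η δ (D.G y) := by
  have hL := hD.L
  have hσ := hD.σ
  have hlx := hD.lambdaMin_Mx_pos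
  have hlM := hD.lambdaMin_M_pos
  obtain ⟨p, hp⟩ := hD.exists_argminSet_F
  have hp : p ∈ argminSet D.F := by rw [hp]; exact Set.mem_singleton p
  obtain ⟨c, hFp, hFs⟩ := hD.fstar_eq hp
  have hG : ∀ x, ∃ a : ℝ, D.F (D.G x) = a := fun x =>
    hD.F_coe (hD.g.ne_top_of_mem_subdiff (hD.G_subdiff x))
  obtain ⟨b, hb⟩ := hG D.xbar
  obtain ⟨a', ha'⟩ := hG y
  rw [hFs, hb] at h
  -- The right-hand side of the hypothesis is a real number, which forces `F(y)` to be finite.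
  have hy : D.g y ≠ ⊤ := by
    intro hy
    rw [hD.F_eq, hy, EReal.top_add_coe, EReal.top_sub_coe, ← EReal.coe_sub, ← EReal.coe_mul,
      ← EReal.coe_strictMono.monotone.map_min, ← EReal.coe_mul, top_le_iff] at h
    exact EReal.coe_ne_top _ h
  obtain ⟨a, ha⟩ := hD.F_coe hy
  rw [ha, ← EReal.coe_sub, ← EReal.coe_sub, ← EReal.coe_mul,
    ← EReal.coe_strictMono.monotone.map_min, ← EReal.coe_mul, EReal.coe_le_coe_iff] at h
  set s := D.L • (y - D.G y) - (D.gradf y - D.gradf (D.G y))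
  have hs : s ∈ subdiff D.F (D.G y) := hD.subgradient_G y
  have hca : c ≤ a' := by
    have := hp (D.G y)
    rwa [hFp, ha', EReal.coe_le_coe_iff] at this
  -- the norm of the subgradient in terms of the gap
  have hs1 : ‖s‖ ^ 2 ≤ 4 * D.L * (a - c) := by
    have h1 := hD.norm_subgradient_G_sq_le y
    -- With `z = x = y` the fundamental inequality becomes sufficient decrease.
    have h2 := hD.F_G_le y y ha' ha
    rw [sub_self, norm_zero] at h2
    have h3 : D.L / 2 * ‖y - D.G y‖ ^ 2 ≤ a - c := by linarith
    have h4 : 4 * D.L * (D.L / 2 * ‖y - D.G y‖ ^ 2) ≤ 4 * D.L * (a - c) := by gcongr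
    refine h1.trans (le_trans (le_of_eq ?_) h4)
    ring
  set R := ‖s‖ / (√(lambdaMin D.Mx) / D.σ) with hR
  have hR0 : 0 ≤ R := by positivity
  have hRsq : R ^ 2 ≤ 4 * D.L * (min (η ^ 2 / (4 * D.L))
      (δ ^ 2 * lambdaMin D.M / (2 * (1 + δ) ^ 2 * D.L ^ 2) * (b - c))) := by
    have e : R ^ 2 = ‖s‖ ^ 2 / (lambdaMin D.Mx / D.σ ^ 2) := by
      rw [hR, div_pow, div_pow, Real.sq_sqrt hlx.le]
    rw [e, div_le_iff₀ (by positivity)]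
    have := mul_le_mul_of_nonneg_left h (by positivity : 0 ≤ 4 * D.L)
    linarith
  refine hD.stopCrit_of_mem_subdiff hs ?_ ?_
  · refine abs_le_of_sq_le_sq' ?_ hη.le |>.2
    refine hRsq.trans ?_
    calc _ ≤ 4 * D.L * (η ^ 2 / (4 * D.L)) := by gcongr; exact min_le_left _ _
      _ = η ^ 2 := by field_simp
  · have hJ := hD.resolventPt_zbar hp
    have hdist := hD.wnorm_sub_resolventPt_le hs
    rw [hJ] at hdist
    set w := pair (D.G y) (D.Lam (D.G y))
    set w' := pair p (D.Lam p) with hw'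
    -- The fundamental inequality from `x̄`, tested at the minimizer `p`.
    have h1 : b - c ≤ D.L / 2 * ‖p - D.xbar‖ ^ 2 := by
      have := hD.F_G_le D.xbar p hb hFp
      have : 0 ≤ D.L / 2 * ‖p - D.G D.xbar‖ ^ 2 := by positivity
      linarith
    have h2 : lambdaMin D.M * ‖p - D.xbar‖ ^ 2 ≤ wnorm D.M (w' - D.zbar) ^ 2 := by
      have := hD.lambdaMin_M_mul_norm_sq_le (w' - D.zbar)
      rwa [hw', zbar, pair_sub, fstBlock_pair, ← pair_sub] at this
    have h3 : R ≤ δ / (1 + δ) * wnorm D.M (w' - D.zbar) := by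
      refine abs_le_of_sq_le_sq' ?_ (mul_nonneg (by positivity) (wnorm_nonneg _ _)) |>.2
      refine hRsq.trans ?_
      calc _ ≤ 4 * D.L * (δ ^ 2 * lambdaMin D.M / (2 * (1 + δ) ^ 2 * D.L ^ 2) *
              (D.L / 2 * ‖p - D.xbar‖ ^ 2)) := by
            gcongr
            exact (min_le_right _ _).trans (by gcongr)
        _ = δ ^ 2 / (1 + δ) ^ 2 * (lambdaMin D.M * ‖p - D.xbar‖ ^ 2) := by
            field_simp
            ring
        _ ≤ δ ^ 2 / (1 + δ) ^ 2 * wnorm D.M (w' - D.zbar) ^ 2 := by gcongr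
        _ = _ := by rw [mul_pow, div_pow]
    have h4 : wnorm D.M (w' - D.zbar) ≤ wnorm D.M (w - D.zbar) + R := by
      have e1 : w' - D.zbar = (w - D.zbar) + (w' - w) := by abel
      have e2 : wnorm D.M (w' - w) = wnorm D.M (w - w') := by
        rw [← neg_sub, wnorm, wnorm, mv, map_neg, inner_neg_neg]
      rw [e1]
      refine (wnorm_add_le hD.M_posDef.posSemidef _ _).trans ?_
      rw [e2]
      linarith
    -- Absorption: with `h3` and `h4`, `(1 + δ) R ≤ δ ‖w' - z̄‖_M ≤ δ ‖w - z̄‖_M + δ R`, and `δ R`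
    -- cancels.
    have hδ' : 0 < 1 + δ := by linarith
    rw [div_mul_eq_mul_div, le_div_iff₀ hδ'] at h3
    have h5 := mul_le_mul_of_nonneg_left h4 hδ.le
    linarith

end Regular

end Data

end ProxMultipliers

theorem mainTheorem5 {n m : ℕ} (hn : 0 < n) (hm : 0 < m)
    (D : ProxMultipliers.Data n m)
    (hf₀_convex : ConvexOn ℝ Set.univ D.f₀)
    (hf₀_diff : Differentiable ℝ D.f₀)
    (hf₀_lip : LipschitzWith D.L₀ (gradient D.f₀))
    (hg : ProxMultipliers.ProperClosedConvex D.g)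
    (hh : ProxMultipliers.ProperClosedConvex D.h)
    (hMx : D.Mx.PosDef) (hMl : D.Ml.PosDef)
    (hσ : 0 < D.σ) (hL : 0 < D.L)
    (η δ : ℝ) (hη : 0 < η) (hδ : 0 < δ) :
    D.WellPosed ∧
    (∀ y : ProxMultipliers.Vec (Fin n),
      D.F y - D.Fstar ≤
        ((ProxMultipliers.lambdaMin D.Mx / D.σ ^ 2 : ℝ) : EReal) *
          min ((η ^ 2 / (4 * D.L) : ℝ) : EReal)
            (((δ ^ 2 * ProxMultipliers.lambdaMin D.M / (2 * (1 + δ) ^ 2 * D.L ^ 2) : ℝ) : EReal) *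
              (D.F (D.G D.xbar) - D.Fstar)) →
      D.StopCrit η δ (D.G y)) ∧
    (∀ x : ProxMultipliers.Vec (Fin n), D.StopCrit η δ x →
      ProxMultipliers.IGPPACond D.T D.M D.σ η δ D.zbar
        (ProxMultipliers.pair x (D.Lam x))) := by
  have hD : D.Regular :=
    ⟨hn, hm, .of_convexOn hf₀_convex hf₀_diff, hf₀_lip, hg, hh.conj, hMx, hMl, hσ, hL⟩
  exact ⟨hD.wellPosed, fun y hy => hD.stopCrit_of_gap_le hη hδ hy,
    fun x hx => hD.igppaCond_of_stopCrit hη hδ hx⟩
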